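/- \textbf{Notation.} For a bounded open convex set $\Omega\subset\mathbb R^2$ let $|\Omega|$ be its Lebesgue measure, $P(\Omega)$ its perimeter (the length of $\partial\Omega$), and $R_\Omega$ its inradius (the supremum of the radii of the balls contained in $\Omega$). For $p>1$ let $u_p\in W^{1,p}_0(\Omega)$ be the $p$-torsion function of $\Omega$, i.e. the unique weak solution of $-\operatorname{div}(|\nabla u|^{p-2}\nabla u)=1$ in $\Omega$, $u=0$ on $\partial\Omega$, and set \[ T_p(\Omega):=\int_\Omega u_p\,dx,\qquad T(p;\Omega):=|\Omega|^{p-1}\,T_p(\Omega)^{1-p},\qquad Q_p(\Omega):=\left(\frac{T(p;\Omega)\,R_\Omega^{\,p}}{\big(\frac{2p-1}{p-1}\big)^{p-1}}\right)^{1/p}. \] Let $\mathcal T$ be the family of all open bounded nondegenerate triangles in $\mathbb R^2$, and put \[ \gamma_{\mathcal T}(p):=\frac{\inf_{T\in\mathcal T}Q_p(T)}{\sup_{T\in\mathcal T}Q_p(T)} . \] \textbf{Proposition.} Let $p>1$. For every $T\in\mathcal T$ one has \[ \frac{R_T\,P(T)}{|T|}=2\qquad\text{and}\qquad 1\le Q_p(T)<2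 . \] Hence $\gamma_{\mathcal T}(p)\ge \tfrac12$. -/

import Mathlib

open MeasureTheory Set Filter Topology
open scoped ContDiff ENNReal Gradient

noncomputable section

namespace PTorsion

/-- Test functions: the class of smooth functions with compact support contained in `Ω`. -/
structure IsTestFunction {D : ℕ} (Ω : Set (EuclideanSpace ℝ (Fin D)))
    (φ : EuclideanSpace ℝ (Fin D) → ℝ) : Prop where
  smooth : ContDiff ℝ ∞ φ
  compact : HasCompactSupport φ
  support_subset : tsupport φ ⊆ Ω

/-- `G` is the weak (distributional) gradient of `u` on `Ω`
(used below for `u` and `G` in some `L^p(Ω)`). -/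
def IsWeakGradient {D : ℕ} (Ω : Set (EuclideanSpace ℝ (Fin D)))
    (u : EuclideanSpace ℝ (Fin D) → ℝ)
    (G : EuclideanSpace ℝ (Fin D) → EuclideanSpace ℝ (Fin D)) : Prop :=
  ∀ φ : EuclideanSpace ℝ (Fin D) → ℝ, IsTestFunction Ω φ →
    ∫ x in Ω, u x • ∇ φ x = - ∫ x in Ω, φ x • G x

/-- `u` belongs to the Sobolev space `W^{1,p}(Ω)`, with weak gradient `G`. -/
structure MemW1 {D : ℕ} (p : ℝ) (Ω : Set (EuclideanSpace ℝ (Fin D)))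
    (u : EuclideanSpace ℝ (Fin D) → ℝ)
    (G : EuclideanSpace ℝ (Fin D) → EuclideanSpace ℝ (Fin D)) : Prop where
  memLp : MemLp u (ENNReal.ofReal p) (volume.restrict Ω)
  memLp_grad : MemLp G (ENNReal.ofReal p) (volume.restrict Ω)
  weakGradient : IsWeakGradient Ω u G

/-- `u` belongs to `W_0^{1,p}(Ω)`, the closure of the test functions in `W^{1,p}(Ω)`,
and `G` is its weak gradient. -/
structure MemW10 {D : ℕ} (p : ℝ) (Ω : Set (EuclideanSpace ℝ (Fin D)))
    (u : EuclideanSpace ℝ (Fin D) → ℝ)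
    (G : EuclideanSpace ℝ (Fin D) → EuclideanSpace ℝ (Fin D)) : Prop
    extends MemW1 p Ω u G where
  approx : ∃ φ : ℕ → EuclideanSpace ℝ (Fin D) → ℝ,
    (∀ n, IsTestFunction Ω (φ n)) ∧
    Tendsto (fun n => eLpNorm (fun x => φ n x - u x) (ENNReal.ofReal p) (volume.restrict Ω))
      atTop (𝓝 0) ∧
    Tendsto (fun n => eLpNorm (fun x => ∇ (φ n) x - G x) (ENNReal.ofReal p) (volume.restrict Ω))
      atTop (𝓝 0)

/-- `u` is a `p`-torsion function on `Ω`: a weak solution in `W_0^{1,p}(Ω)` of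
`-div (|∇u|^{p-2} ∇u) = 1` in `Ω`, `u = 0` on `∂Ω`.
(Where `G x = 0` the field `‖G x‖ ^ (p - 2) • G x` is `0`, as it should be.) -/
def IsTorsionFunction {D : ℕ} (p : ℝ) (Ω : Set (EuclideanSpace ℝ (Fin D)))
    (u : EuclideanSpace ℝ (Fin D) → ℝ) : Prop :=
  ∃ G : EuclideanSpace ℝ (Fin D) → EuclideanSpace ℝ (Fin D), MemW10 p Ω u G ∧
    ∀ φ : EuclideanSpace ℝ (Fin D) → ℝ, IsTestFunction Ω φ →
      ∫ x in Ω, inner ℝ (‖G x‖ ^ (p - 2) • G x) (∇ φ x) = ∫ x in Ω, φ x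

open Classical in
/-- The `p`-torsional rigidity `T_p(Ω) = ∫_Ω u_p`, where `u_p` is the `p`-torsion function of `Ω`.
For a bounded open convex `Ω` and `p > 1` the torsion function exists and is unique up to
equality almost everywhere on `Ω`, so the choice does not affect the integral; the value `0`
is a placeholder for the case that there is none. -/
def torsionalRigidity {D : ℕ} (p : ℝ) (Ω : Set (EuclideanSpace ℝ (Fin D))) : ℝ :=
  if h : ∃ u, IsTorsionFunction p Ω u then ∫ x in Ω, h.choose x else 0

/-- The normalized rigidity `T(p;Ω) = |Ω|^{p-1} T_p(Ω)^{1-p}`. -/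
def normalizedRigidity {D : ℕ} (p : ℝ) (Ω : Set (EuclideanSpace ℝ (Fin D))) : ℝ :=
  (volume.real Ω) ^ (p - 1) * torsionalRigidity p Ω ^ (1 - p)

/-- The inradius `R_Ω`: the supremum of the radii of the balls contained in `Ω`. -/
def inradius {D : ℕ} (Ω : Set (EuclideanSpace ℝ (Fin D))) : ℝ :=
  sSup {r : ℝ | 0 ≤ r ∧ ∃ c, Metric.ball c r ⊆ Ω}

/-- The scale-invariant functional
`Q_p(Ω) = (T(p;Ω) R_Ω^p / ((2p-1)/(p-1))^{p-1})^{1/p}`. -/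
def Q {D : ℕ} (p : ℝ) (Ω : Set (EuclideanSpace ℝ (Fin D))) : ℝ :=
  (normalizedRigidity p Ω * inradius Ω ^ p / ((2 * p - 1) / (p - 1)) ^ (p - 1)) ^ (1 / p)

/-- `α_𝓕(p) = inf_{Ω ∈ 𝓕} Q_p(Ω)`. -/
def alpha {D : ℕ} (F : Set (Set (EuclideanSpace ℝ (Fin D)))) (p : ℝ) : ℝ :=
  sInf (Q p '' F)

/-- `β_𝓕(p) = sup_{Ω ∈ 𝓕} Q_p(Ω)`. -/
def beta {D : ℕ} (F : Set (Set (EuclideanSpace ℝ (Fin D)))) (p : ℝ) : ℝ :=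
  sSup (Q p '' F)

/-- `γ_𝓕(p) = α_𝓕(p) / β_𝓕(p)`. -/
def gamma {D : ℕ} (F : Set (Set (EuclideanSpace ℝ (Fin D)))) (p : ℝ) : ℝ :=
  alpha F p / beta F p

/-- The perimeter of a planar domain: the length (one-dimensional Hausdorff measure)
of its boundary. -/
def perimeter (Ω : Set (EuclideanSpace ℝ (Fin 2))) : ℝ :=
  (Measure.hausdorffMeasure 1 : Measure (EuclideanSpace ℝ (Fin 2))).real (frontier Ω)

/-- The family of all (open, bounded, nondegenerate) triangles in the plane. -/
def triangles : Set (Set (EuclideanSpace ℝ (Fin 2))) :=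
  {Ω | ∃ a b c : EuclideanSpace ℝ (Fin 2), AffineIndependent ℝ ![a, b, c] ∧
    Ω = interior (convexHull ℝ {a, b, c})}

end PTorsion

end

/-!
Let `q` be the conjugate exponent of `p`. A triangle is a polytope circumscribed about a ball, and
for such a polytope of dimension `D`, volume `V` and inradius `R` the definition of `Q_p` amounts
to `Q_p ^ q = R ^ q V / ((q + 1) T_p)`.

* `Q_p ≥ 1`, that is `T_p ≤ R ^ q V / (q + 1)`: divide the polytope into the regions nearest to each
  of its faces. Each region is the subgraph of a function with values in `[0, R]` over its face, so
  that integrating by parts along the normal and Hölder's inequality bound the integral of a test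
  function by the `L^p` norm of its gradient.
* `Q_p < D`: let `g` be the gauge of the polytope about the incentre. The distance of the faces from
  the incentre is `R`, so that `‖∇g‖ = 1 / R`, and the sublevel sets of `g` are homothetic copies of
  the polytope, so that `∫ g ^ q = V D / (q + D)`. Testing with `1 - g ^ q` gives
  `T_p ≥ R ^ q V / ((q + D) D ^ (q - 1))`, and `q + D < D (q + 1)`. As `g` is a maximum of affine
  functions, the test functions are made from a smooth maximum.

The torsion function exists by the direct method, minimizing sequences being Cauchy by the uniform
convexity of `‖·‖ ^ p`. Finally, turning the sides of a triangle `T` by a right angle gives `2 |T|`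
times the gradients of the barycentric coordinates `λ_i`, whence `P(T) = 2 |T| ∑ ‖∇λ_i‖`, while the
inradius is `(∑ ‖∇λ_i‖)⁻¹`.
-/

noncomputable section

namespace PTorsion

section UniformConvexity

variable {F : Type*} [NormedAddCommGroup F] {p : ℝ}

theorem continuous_norm_rpow (hp : 0 ≤ p) : Continuous fun a : F => ‖a‖ ^ p :=
  continuous_norm.rpow_const fun _ => Or.inr hp

variable [NormedSpace ℝ F]

/-- The defect of midpoint convexity of `‖·‖ ^ p` at `a` and `b`, which measures quantitatively how
far apart `a` and `b` are. -/
def midpointDefect (p : ℝ) (a b : F) : ℝ :=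
  (‖a‖ ^ p + ‖b‖ ^ p) / 2 - ‖(1 / 2 : ℝ) • (a + b)‖ ^ p

theorem norm_smul_rpow (c : ℝ) (a : F) : ‖c • a‖ ^ p = |c| ^ p * ‖a‖ ^ p := by
  rw [norm_smul, Real.norm_eq_abs, Real.mul_rpow (abs_nonneg c) (norm_nonneg a)]

theorem midpointDefect_smul (c : ℝ) (a b : F) :
    midpointDefect p (c • a) (c • b) = |c| ^ p * midpointDefect p a b := by
  simp only [midpointDefect, ← smul_add, smul_comm (1 / 2 : ℝ) c, norm_smul_rpow c]
  ring

theorem midpointDefect_self (a : F) : midpointDefect p a a = 0 := by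
  rw [midpointDefect, ← two_smul ℝ a, smul_smul]
  norm_num

theorem midpointDefect_pos [StrictConvexSpace ℝ F] (hp : 1 < p) {a b : F} (hab : a ≠ b) :
    0 < midpointDefect p a b := by
  have hp0 : 0 < p := by linarith
  rw [midpointDefect, sub_pos]
  by_cases hnorm : ‖a‖ = ‖b‖
  · have hlt : ‖(1 / 2 : ℝ) • (a + b)‖ ^ p < ‖a‖ ^ p :=
      Real.rpow_lt_rpow (norm_nonneg _) ((norm_midpoint_lt_iff hnorm).2 hab) hp0
    rw [← hnorm]
    linarith
  · have htri : ‖(1 / 2 : ℝ) • (a + b)‖ ≤ (1 / 2 : ℝ) * ‖a‖ + (1 / 2 : ℝ) * ‖b‖ := by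
      rw [norm_smul, ← mul_add, Real.norm_of_nonneg (by norm_num)]
      gcongr
      exact norm_add_le a b
    have hconv : ((1 / 2 : ℝ) * ‖a‖ + (1 / 2 : ℝ) * ‖b‖) ^ p <
        (1 / 2 : ℝ) * ‖a‖ ^ p + (1 / 2 : ℝ) * ‖b‖ ^ p := by
      simpa only [smul_eq_mul] using (strictConvexOn_rpow hp).2 (norm_nonneg a) (norm_nonneg b)
        hnorm (by norm_num : (0 : ℝ) < 1 / 2) (by norm_num : (0 : ℝ) < 1 / 2) (by norm_num)
    calc ‖(1 / 2 : ℝ) • (a + b)‖ ^ p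
        ≤ ((1 / 2 : ℝ) * ‖a‖ + (1 / 2 : ℝ) * ‖b‖) ^ p :=
          Real.rpow_le_rpow (norm_nonneg _) htri hp0.le
      _ < (1 / 2 : ℝ) * ‖a‖ ^ p + (1 / 2 : ℝ) * ‖b‖ ^ p := hconv
      _ = (‖a‖ ^ p + ‖b‖ ^ p) / 2 := by ring

theorem midpointDefect_nonneg [StrictConvexSpace ℝ F] (hp : 1 < p) (a b : F) :
    0 ≤ midpointDefect p a b := by
  rcases eq_or_ne a b with rfl | hab
  · exact (midpointDefect_self a).ge
  · exact (midpointDefect_pos hp hab).le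

theorem continuous_midpointDefect (hp : 0 ≤ p) :
    Continuous fun z : F × F => midpointDefect p z.1 z.2 := by
  have hnorm := continuous_norm_rpow (F := F) hp
  unfold midpointDefect
  exact (((hnorm.comp continuous_fst).add (hnorm.comp continuous_snd)).div_const 2).sub
    (hnorm.comp ((continuous_fst.add continuous_snd).const_smul (1 / 2 : ℝ)))

theorem isCompact_unit_pairs [FiniteDimensional ℝ F] (hp : 0 < p) :
    IsCompact {z : F × F | ‖z.1‖ ^ p + ‖z.2‖ ^ p = 1} := by
  refine Metric.isCompact_of_isClosed_isBounded ?_ ?_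
  · exact isClosed_eq (((continuous_norm_rpow hp.le).comp continuous_fst).add
      ((continuous_norm_rpow hp.le).comp continuous_snd)) continuous_const
  · refine (Metric.isBounded_closedBall (x := (0 : F × F)) (r := 1)).subset ?_
    rintro ⟨a, b⟩ (hab : ‖a‖ ^ p + ‖b‖ ^ p = 1)
    have ha : 0 ≤ ‖a‖ ^ p := by positivity
    have hb : 0 ≤ ‖b‖ ^ p := by positivity
    rw [mem_closedBall_zero_iff, Prod.norm_def]
    exact max_le (le_of_not_gt fun h => (Real.one_lt_rpow h hp).not_ge (by linarith))
      (le_of_not_gt fun h => (Real.one_lt_rpow h hp).not_ge (by linarith))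

theorem exists_norm_sub_rpow_le_of_unit [FiniteDimensional ℝ F] [StrictConvexSpace ℝ F]
    (hp : 1 < p) {ε : ℝ} (hε : 0 < ε) : ∃ C : ℝ, 0 ≤ C ∧ ∀ a b : F, ‖a‖ ^ p + ‖b‖ ^ p = 1 →
      ‖a - b‖ ^ p ≤ ε + C * midpointDefect p a b := by
  have hp0 : 0 < p := by linarith
  have hdist : Continuous fun z : F × F => ‖z.1 - z.2‖ ^ p :=
    (continuous_norm_rpow hp0.le).comp (continuous_fst.sub continuous_snd)
  have hdefect := continuous_midpointDefect (F := F) hp0.le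
  set K : Set (F × F) := {z | ‖z.1‖ ^ p + ‖z.2‖ ^ p = 1} ∩ {z | ε ≤ ‖z.1 - z.2‖ ^ p}
  have hK : IsCompact K :=
    (isCompact_unit_pairs hp0).inter_right (isClosed_le continuous_const hdist)
  have hpos : ∀ z ∈ K, 0 < midpointDefect p z.1 z.2 := fun z hz => by
    refine midpointDefect_pos hp fun heq => hε.not_ge ?_
    simpa [heq, Real.zero_rpow hp0.ne'] using hz.2
  obtain ⟨C, hC⟩ := hK.bddAbove_image
    (hdist.continuousOn.div hdefect.continuousOn fun z hz => (hpos z hz).ne')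
  refine ⟨max C 0, le_max_right _ _, fun a b hab => ?_⟩
  have hnonneg := mul_nonneg (le_max_right C 0) (midpointDefect_nonneg hp a b)
  by_cases hfar : ε ≤ ‖a - b‖ ^ p
  · have hratio : ‖a - b‖ ^ p / midpointDefect p a b ≤ max C 0 :=
      (hC (mem_image_of_mem _ (show (a, b) ∈ K from ⟨hab, hfar⟩))).trans (le_max_left _ _)
    rw [div_le_iff₀ (hpos (a, b) ⟨hab, hfar⟩)] at hratio
    linarith
  · linarith

/-- Uniform convexity of `‖·‖ ^ p`: the unit case is a compactness argument, and both sides are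
homogeneous of degree `p`. -/
theorem exists_norm_sub_rpow_le [FiniteDimensional ℝ F] [StrictConvexSpace ℝ F]
    (hp : 1 < p) {ε : ℝ} (hε : 0 < ε) : ∃ C : ℝ, 0 ≤ C ∧ ∀ a b : F,
      ‖a - b‖ ^ p ≤ ε * (‖a‖ ^ p + ‖b‖ ^ p) + C * midpointDefect p a b := by
  have hp0 : 0 < p := by linarith
  obtain ⟨C, hC, hunit⟩ := exists_norm_sub_rpow_le_of_unit (F := F) hp hε
  refine ⟨C, hC, fun a b => ?_⟩
  set s := ‖a‖ ^ p + ‖b‖ ^ p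
  have ha : 0 ≤ ‖a‖ ^ p := by positivity
  have hb : 0 ≤ ‖b‖ ^ p := by positivity
  rcases (add_nonneg ha hb).eq_or_lt with hzero | hpos
  · have ha0 : a = 0 := norm_eq_zero.1
      ((Real.rpow_eq_zero (norm_nonneg a) hp0.ne').1 (by linarith))
    have hb0 : b = 0 := norm_eq_zero.1
      ((Real.rpow_eq_zero (norm_nonneg b) hp0.ne').1 (by linarith))
    simp [s, ha0, hb0, midpointDefect_self, Real.zero_rpow hp0.ne']
  · replace hpos : 0 < s := hpos
    have hscale : |s ^ (-(1 / p))| ^ p = s⁻¹ := by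
      rw [abs_of_nonneg (by positivity), ← Real.rpow_mul hpos.le, neg_mul,
        one_div_mul_cancel hp0.ne', Real.rpow_neg_one]
    have hscaled := hunit (s ^ (-(1 / p)) • a) (s ^ (-(1 / p)) • b) (by
      rw [norm_smul_rpow, norm_smul_rpow, hscale, ← mul_add, inv_mul_cancel₀ hpos.ne'])
    rw [midpointDefect_smul, ← smul_sub, norm_smul_rpow, hscale] at hscaled
    calc ‖a - b‖ ^ p = s * (s⁻¹ * ‖a - b‖ ^ p) := by field_simp
      _ ≤ s * (ε + C * (s⁻¹ * midpointDefect p a b)) := by gcongr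
      _ = ε * s + C * midpointDefect p a b := by field_simp

end UniformConvexity

section Lp

variable {α : Type*} [MeasurableSpace α] {μ : Measure α} {F : Type*} [NormedAddCommGroup F]
  {p : ℝ}

theorem integral_norm_rpow_nonneg (f : α → F) : 0 ≤ ∫ x, ‖f x‖ ^ p ∂μ :=
  integral_nonneg fun _ => by positivity

theorem integral_norm_rpow_eq (hp : 0 < p) {f : α → F} (hf : MemLp f (ENNReal.ofReal p) μ) :
    ∫ x, ‖f x‖ ^ p ∂μ = ‖hf.toLp f‖ ^ p := by
  have hnonneg := integral_norm_rpow_nonneg (μ := μ) (p := p) f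
  rw [Lp.norm_toLp, hf.eLpNorm_eq_integral_rpow_norm (by simpa using hp) (by simp),
    ENNReal.toReal_ofReal hp.le, ENNReal.toReal_ofReal (by positivity),
    ← Real.rpow_mul hnonneg, inv_mul_cancel₀ hp.ne', Real.rpow_one]

theorem integrable_norm_rpow (hp : 0 < p) {f : α → F} (hf : MemLp f (ENNReal.ofReal p) μ) :
    Integrable (fun x => ‖f x‖ ^ p) μ := by
  simpa [ENNReal.toReal_ofReal hp.le] using
    hf.integrable_norm_rpow (by simpa using hp) (by simp)

theorem memLp_norm_rpow_sub_one (hp : 1 < p) {f : α → F} (hf : MemLp f (ENNReal.ofReal p) μ) :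
    MemLp (fun x => ‖f x‖ ^ (p - 1)) (ENNReal.ofReal p.conjExponent) μ := by
  have hp1 : 0 < p - 1 := by linarith
  have := hf.norm_rpow_div (ENNReal.ofReal (p - 1))
  rwa [ENNReal.toReal_ofReal hp1.le, ← ENNReal.ofReal_div_of_pos hp1] at this

theorem integrable_norm_rpow_sub_one_mul_norm (hp : 1 < p) {f : α → F} {F' : Type*}
    [NormedAddCommGroup F'] {g : α → F'} (hf : MemLp f (ENNReal.ofReal p) μ)
    (hg : MemLp g (ENNReal.ofReal p) μ) : Integrable (fun x => ‖f x‖ ^ (p - 1) * ‖g x‖) μ := by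
  have : ENNReal.HolderTriple (ENNReal.ofReal p.conjExponent) (ENNReal.ofReal p) 1 :=
    (Real.HolderConjugate.conjExponent hp).symm.ennrealOfReal
  exact (memLp_norm_rpow_sub_one hp hf).integrable_mul hg.norm

theorem integral_norm_rpow_sub_one_mul_norm_le (hp : 1 < p) {f : α → F} {F' : Type*}
    [NormedAddCommGroup F'] {g : α → F'} (hf : MemLp f (ENNReal.ofReal p) μ)
    (hg : MemLp g (ENNReal.ofReal p) μ) :
    ∫ x, ‖f x‖ ^ (p - 1) * ‖g x‖ ∂μ ≤
      (∫ x, ‖f x‖ ^ p ∂μ) ^ (1 - 1 / p) * (∫ x, ‖g x‖ ^ p ∂μ) ^ (1 / p) := by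
  have hconj := Real.HolderConjugate.conjExponent hp
  have hholder := integral_mul_norm_le_Lp_mul_Lq hconj.symm (memLp_norm_rpow_sub_one hp hf) hg.norm
  have hnorm (x : α) : ‖‖f x‖ ^ (p - 1)‖ = ‖f x‖ ^ (p - 1) := Real.norm_of_nonneg (by positivity)
  have hpow (x : α) : (‖f x‖ ^ (p - 1)) ^ p.conjExponent = ‖f x‖ ^ p := by
    rw [← Real.rpow_mul (norm_nonneg _), hconj.sub_one_mul_conj]
  have hexp : 1 / p.conjExponent = 1 - 1 / p := by
    rw [one_div, one_div, ← hconj.inv_add_inv_eq_one, add_sub_cancel_left]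
  simpa only [hnorm, hpow, hexp, norm_norm] using hholder

theorem abs_integral_le_rpow [IsFiniteMeasure μ] (hp : 1 < p) {f : α → ℝ}
    (hf : MemLp f (ENNReal.ofReal p) μ) :
    |∫ x, f x ∂μ| ≤ (μ.real univ) ^ (1 - 1 / p) * (∫ x, ‖f x‖ ^ p ∂μ) ^ (1 / p) := by
  have hholder := integral_norm_rpow_sub_one_mul_norm_le hp (memLp_const (1 : ℝ)) hf
  simp only [norm_one, Real.one_rpow, one_mul, integral_const, smul_eq_mul, mul_one] at hholder
  exact (norm_integral_le_integral_norm f).trans hholder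

theorem exists_memLp_limit [CompleteSpace F] (hp : 1 ≤ p) {f : ℕ → α → F}
    (hf : ∀ n, MemLp (f n) (ENNReal.ofReal p) μ)
    (hcauchy : ∀ ε > 0, ∃ N, ∀ k ≥ N, ∀ l ≥ N, ∫ x, ‖f k x - f l x‖ ^ p ∂μ < ε) :
    ∃ g, MemLp g (ENNReal.ofReal p) μ ∧
      Tendsto (fun n => eLpNorm (fun x => f n x - g x) (ENNReal.ofReal p) μ) atTop (𝓝 0) := by
  have hp0 : 0 < p := by linarith
  have : Fact (1 ≤ ENNReal.ofReal p) := ⟨by simpa using hp⟩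
  have hLp : CauchySeq fun n => (hf n).toLp (f n) := by
    refine Metric.cauchySeq_iff.2 fun ε hε => ?_
    obtain ⟨N, hN⟩ := hcauchy (ε ^ p) (by positivity)
    refine ⟨N, fun k hk l hl => ?_⟩
    rw [dist_eq_norm, ← Real.rpow_lt_rpow_iff (norm_nonneg _) hε.le hp0, ← MemLp.toLp_sub,
      ← integral_norm_rpow_eq hp0]
    exact hN k hk l hl
  obtain ⟨g, hg⟩ := cauchySeq_tendsto_of_complete hLp
  exact ⟨g, Lp.memLp g, (Lp.tendsto_Lp_iff_tendsto_eLpNorm'' f hf g (Lp.memLp g)).1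
    (by simpa using hg)⟩

theorem tendsto_integral_norm_rpow (hp : 1 ≤ p) {f : ℕ → α → F} {g : α → F}
    (hf : ∀ n, MemLp (f n) (ENNReal.ofReal p) μ) (hg : MemLp g (ENNReal.ofReal p) μ)
    (h : Tendsto (fun n => eLpNorm (fun x => f n x - g x) (ENNReal.ofReal p) μ) atTop (𝓝 0)) :
    Tendsto (fun n => ∫ x, ‖f n x‖ ^ p ∂μ) atTop (𝓝 (∫ x, ‖g x‖ ^ p ∂μ)) := by
  have hp0 : 0 < p := by linarith
  have : Fact (1 ≤ ENNReal.ofReal p) := ⟨by simpa using hp⟩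
  simp only [integral_norm_rpow_eq hp0 (hf _), integral_norm_rpow_eq hp0 hg]
  exact ((Lp.tendsto_Lp_iff_tendsto_eLpNorm'' f hf g hg).2 h).norm.rpow_const (Or.inr hp0.le)

theorem tendsto_integral_bilin {E G : Type*} [NormedSpace ℝ F] [NormedAddCommGroup E]
    [NormedSpace ℝ E] [NormedAddCommGroup G] [NormedSpace ℝ G] [CompleteSpace G] (hp : 1 < p)
    (B : F →L[ℝ] E →L[ℝ] G) {f : ℕ → α → F} {g : α → F} {w : α → E}
    (hf : ∀ n, MemLp (f n) (ENNReal.ofReal p) μ) (hg : MemLp g (ENNReal.ofReal p) μ)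
    (hw : MemLp w (ENNReal.ofReal p.conjExponent) μ)
    (h : Tendsto (fun n => eLpNorm (fun x => f n x - g x) (ENNReal.ofReal p) μ) atTop (𝓝 0)) :
    Tendsto (fun n => ∫ x, B (f n x) (w x) ∂μ) atTop (𝓝 (∫ x, B (g x) (w x) ∂μ)) := by
  have hconj := Real.HolderConjugate.conjExponent hp
  have : ENNReal.HolderConjugate (ENNReal.ofReal p) (ENNReal.ofReal p.conjExponent) :=
    hconj.ennrealOfReal
  have : Fact (1 ≤ ENNReal.ofReal p) := ⟨by simpa using hp.le⟩
  have : Fact (1 ≤ ENNReal.ofReal p.conjExponent) := ⟨by simpa using hconj.symm.lt.le⟩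
  have hpairing {u : α → F} (hu : MemLp u (ENNReal.ofReal p) μ) :
      B.lpPairing μ _ _ (hu.toLp u) (hw.toLp w) = ∫ x, B (u x) (w x) ∂μ := by
    rw [B.lpPairing_eq_integral]
    refine integral_congr_ae ?_
    filter_upwards [hu.coeFn_toLp, hw.coeFn_toLp] with x hux hwx
    rw [hux, hwx]
  simp only [← hpairing (hf _), ← hpairing hg]
  exact (((B.lpPairing μ _ _).continuous.clm_apply continuous_const).tendsto _).comp
    ((Lp.tendsto_Lp_iff_tendsto_eLpNorm'' f hf g hg).2 h)

theorem tendsto_integral_of_tendsto_eLpNorm [IsFiniteMeasure μ] (hp : 1 < p) {f : ℕ → α → ℝ}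
    {g : α → ℝ} (hf : ∀ n, MemLp (f n) (ENNReal.ofReal p) μ) (hg : MemLp g (ENNReal.ofReal p) μ)
    (h : Tendsto (fun n => eLpNorm (fun x => f n x - g x) (ENNReal.ofReal p) μ) atTop (𝓝 0)) :
    Tendsto (fun n => ∫ x, f n x ∂μ) atTop (𝓝 (∫ x, g x ∂μ)) := by
  simpa using tendsto_integral_bilin hp (ContinuousLinearMap.mul ℝ ℝ) hf hg
    (memLp_const (1 : ℝ)) h

end Lp

section UniformConvexityLp

variable {α F : Type*} [MeasurableSpace α] {μ : Measure α} [NormedAddCommGroup F] [NormedSpace ℝ F]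
  {p : ℝ}

theorem integrable_midpointDefect (hp : 0 < p) {f g : α → F}
    (hf : MemLp f (ENNReal.ofReal p) μ) (hg : MemLp g (ENNReal.ofReal p) μ) :
    Integrable (fun x => midpointDefect p (f x) (g x)) μ :=
  (((integrable_norm_rpow hp hf).add (integrable_norm_rpow hp hg)).div_const 2).sub
    (integrable_norm_rpow hp ((hf.add hg).const_smul (1 / 2 : ℝ)))

theorem exists_integral_norm_sub_rpow_le [FiniteDimensional ℝ F] [StrictConvexSpace ℝ F]
    (hp : 1 < p) {ε : ℝ} (hε : 0 < ε) : ∃ C : ℝ, 0 ≤ C ∧ ∀ f g : α → F,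
      MemLp f (ENNReal.ofReal p) μ → MemLp g (ENNReal.ofReal p) μ →
      ∫ x, ‖f x - g x‖ ^ p ∂μ ≤ ε * ((∫ x, ‖f x‖ ^ p ∂μ) + ∫ x, ‖g x‖ ^ p ∂μ) +
        C * ∫ x, midpointDefect p (f x) (g x) ∂μ := by
  have hp0 : 0 < p := by linarith
  obtain ⟨C, hC, hconvex⟩ := exists_norm_sub_rpow_le (F := F) hp hε
  refine ⟨C, hC, fun f g hf hg => ?_⟩
  have hintf := integrable_norm_rpow hp0 hf
  have hintg := integrable_norm_rpow hp0 hg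
  have hintsum : Integrable (fun x => ε * (‖f x‖ ^ p + ‖g x‖ ^ p)) μ :=
    (hintf.add hintg).const_mul ε
  have hintdefect := (integrable_midpointDefect hp0 hf hg).const_mul C
  calc ∫ x, ‖f x - g x‖ ^ p ∂μ
      ≤ ∫ x, (ε * (‖f x‖ ^ p + ‖g x‖ ^ p) + C * midpointDefect p (f x) (g x)) ∂μ :=
        integral_mono (integrable_norm_rpow hp0 (hf.sub hg)) (hintsum.add hintdefect)
          fun x => hconvex _ _
    _ = ε * ((∫ x, ‖f x‖ ^ p ∂μ) + ∫ x, ‖g x‖ ^ p ∂μ) +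
          C * ∫ x, midpointDefect p (f x) (g x) ∂μ := by
        rw [integral_add hintsum hintdefect, integral_const_mul, integral_const_mul,
          integral_add hintf hintg]

end UniformConvexityLp

section TestFunctions

variable {D : ℕ} {Ω : Set (EuclideanSpace ℝ (Fin D))} {φ ψ : EuclideanSpace ℝ (Fin D) → ℝ}

namespace IsTestFunction

theorem differentiable (hφ : IsTestFunction Ω φ) : Differentiable ℝ φ :=
  hφ.smooth.differentiable (by simp)

theorem continuous (hφ : IsTestFunction Ω φ) : Continuous φ :=
  hφ.smooth.continuous

theorem zero : IsTestFunction Ω 0 :=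
  ⟨contDiff_const, HasCompactSupport.zero, by simp [tsupport]⟩

theorem add (hφ : IsTestFunction Ω φ) (hψ : IsTestFunction Ω ψ) : IsTestFunction Ω (φ + ψ) :=
  ⟨hφ.smooth.add hψ.smooth, hφ.compact.add hψ.compact,
    (tsupport_add φ ψ).trans (union_subset hφ.support_subset hψ.support_subset)⟩

theorem smul (c : ℝ) (hφ : IsTestFunction Ω φ) : IsTestFunction Ω (c • φ) :=
  ⟨hφ.smooth.const_smul c, hφ.compact.smul_left,
    (tsupport_smul_subset_right (fun _ => c) φ).trans hφ.support_subset⟩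

theorem gradient_add (hφ : IsTestFunction Ω φ) (hψ : IsTestFunction Ω ψ) :
    ∇ (φ + ψ) = ∇ φ + ∇ ψ := by
  ext1 x
  simp [gradient, fderiv_add (hφ.differentiable x) (hψ.differentiable x)]

theorem gradient_smul (c : ℝ) (hφ : IsTestFunction Ω φ) : ∇ (c • φ) = c • ∇ φ := by
  ext1 x
  simp [gradient, fderiv_const_smul (hφ.differentiable x)]

theorem continuous_gradient (hφ : IsTestFunction Ω φ) : Continuous (∇ φ) :=
  (LinearIsometryEquiv.continuous _).comp (hφ.smooth.continuous_fderiv (by simp))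

theorem hasCompactSupport_gradient (hφ : IsTestFunction Ω φ) : HasCompactSupport (∇ φ) :=
  (hφ.compact.fderiv ℝ).comp_left (g := (InnerProductSpace.toDual ℝ _).symm) (map_zero _)

theorem eq_zero_of_notMem (hφ : IsTestFunction Ω φ) {x : EuclideanSpace ℝ (Fin D)} (hx : x ∉ Ω) :
    φ x = 0 :=
  image_eq_zero_of_notMem_tsupport fun hx' => hx (hφ.support_subset hx')

theorem integrable (hφ : IsTestFunction Ω φ) : Integrable φ (volume.restrict Ω) :=
  (hφ.continuous.integrable_of_hasCompactSupport hφ.compact).restrict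

theorem memLp (hφ : IsTestFunction Ω φ) (q : ℝ≥0∞) : MemLp φ q (volume.restrict Ω) :=
  (hφ.continuous.memLp_of_hasCompactSupport hφ.compact).restrict Ω

theorem memLp_gradient (hφ : IsTestFunction Ω φ) (q : ℝ≥0∞) :
    MemLp (∇ φ) q (volume.restrict Ω) :=
  (hφ.continuous_gradient.memLp_of_hasCompactSupport hφ.hasCompactSupport_gradient).restrict Ω

theorem integral_mul_fderiv (hφ : IsTestFunction Ω φ) (hψ : IsTestFunction Ω ψ)
    (v : EuclideanSpace ℝ (Fin D)) :
    ∫ x, φ x * fderiv ℝ ψ x v = -∫ x, fderiv ℝ φ x v * ψ x := by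
  have hcontinuous {f : EuclideanSpace ℝ (Fin D) → ℝ} (hf : IsTestFunction Ω f) :
      Continuous fun x => fderiv ℝ f x v :=
    (hf.smooth.continuous_fderiv (by simp)).clm_apply continuous_const
  exact integral_mul_fderiv_eq_neg_fderiv_mul_of_integrable
    (((hcontinuous hφ).mul hψ.continuous).integrable_of_hasCompactSupport hψ.compact.mul_left)
    ((hφ.continuous.mul (hcontinuous hψ)).integrable_of_hasCompactSupport hφ.compact.mul_right)
    ((hφ.continuous.mul hψ.continuous).integrable_of_hasCompactSupport hψ.compact.mul_left)
    (fun x _ => hφ.differentiable x) (fun x _ => hψ.differentiable x)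

theorem integral_smul_gradient_eq (hφ : IsTestFunction Ω φ) :
    ∫ x in Ω, φ x • ∇ ψ x = ∫ x, φ x • ∇ ψ x :=
  setIntegral_eq_integral_of_forall_compl_eq_zero fun x hx => by
    rw [hφ.eq_zero_of_notMem hx, zero_smul]

theorem isWeakGradient (hφ : IsTestFunction Ω φ) : IsWeakGradient Ω φ (∇ φ) := by
  intro ψ hψ
  have hintegrable {f g : EuclideanSpace ℝ (Fin D) → ℝ} (hf : IsTestFunction Ω f)
      (hg : IsTestFunction Ω g) : Integrable fun x => f x • ∇ g x :=
    (hf.continuous.smul hg.continuous_gradient).integrable_of_hasCompactSupport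
      hf.compact.smul_right
  have hinner (f : EuclideanSpace ℝ (Fin D) → ℝ) (v x : EuclideanSpace ℝ (Fin D)) :
      inner ℝ v (∇ f x) = fderiv ℝ f x v := by
    rw [inner_gradient_right, conj_trivial]
  rw [hφ.integral_smul_gradient_eq, hψ.integral_smul_gradient_eq]
  refine ext_inner_left ℝ fun v => ?_
  rw [inner_neg_right, ← integral_inner (hintegrable hφ hψ), ← integral_inner (hintegrable hψ hφ)]
  simpa only [inner_smul_right, hinner, mul_comm] using hφ.integral_mul_fderiv hψ v

theorem memW10 (hφ : IsTestFunction Ω φ) (p : ℝ) : MemW10 p Ω φ (∇ φ) where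
  memLp := hφ.memLp _
  memLp_grad := hφ.memLp_gradient _
  weakGradient := hφ.isWeakGradient
  approx := ⟨fun _ => φ, fun _ => hφ, by simp, by simp⟩

end IsTestFunction

end TestFunctions

section Poincare

theorem le_rpow_mul_of_le_mul_rpow {p A X Y : ℝ} (hp : 1 < p) (hA : 0 ≤ A) (hX : 0 ≤ X)
    (hY : 0 ≤ Y) (h : X ≤ A * (X ^ (1 - 1 / p) * Y ^ (1 / p))) : X ≤ A ^ p * Y := by
  have hp0 : 0 < p := by linarith
  rcases hX.eq_or_lt with rfl | hpos
  · positivity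
  · have hroot : X ^ (1 / p) ≤ A * Y ^ (1 / p) := by
      refine le_of_mul_le_mul_left ?_ (Real.rpow_pos_of_pos hpos (1 - 1 / p))
      rw [← Real.rpow_add hpos, sub_add_cancel, Real.rpow_one]
      linarith
    calc X = (X ^ (1 / p)) ^ p := by
          rw [← Real.rpow_mul hX, one_div_mul_cancel hp0.ne', Real.rpow_one]
      _ ≤ (A * Y ^ (1 / p)) ^ p := Real.rpow_le_rpow (by positivity) hroot hp0.le
      _ = A ^ p * Y := by
          rw [Real.mul_rpow hA (by positivity), ← Real.rpow_mul hY, one_div_mul_cancel hp0.ne',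
            Real.rpow_one]

theorem integral_eq_neg_integral_inner_mul_fderiv {V : Type*} [NormedAddCommGroup V]
    [InnerProductSpace ℝ V] [FiniteDimensional ℝ V] [MeasurableSpace V] [BorelSpace V]
    {μ : Measure V} [μ.IsAddHaarMeasure] {e : V} (he : ‖e‖ = 1) {f : V → ℝ} (hf : ContDiff ℝ 1 f)
    (hsupp : HasCompactSupport f) : ∫ x, f x ∂μ = -∫ x, inner ℝ e x * fderiv ℝ f x e ∂μ := by
  have hinner : Continuous fun x : V => inner ℝ e x := by fun_prop
  have hfderiv : Continuous fun x => fderiv ℝ f x e :=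
    (hf.continuous_fderiv (by simp)).clm_apply continuous_const
  have hone (x : V) : fderiv ℝ (fun x => inner ℝ e x) x e = 1 := by
    rw [show fderiv ℝ (fun x => inner ℝ e x) x = innerSL ℝ e from (innerSL ℝ e).fderiv,
      innerSL_apply_apply, real_inner_self_eq_norm_sq, he, one_pow]
  have hparts := integral_mul_fderiv_eq_neg_fderiv_mul_of_integrable (μ := μ)
    (f := fun x => inner ℝ e x) (g := f) (v := e)
    (by simpa only [hone, one_mul] using hf.continuous.integrable_of_hasCompactSupport hsupp)
    ((hinner.mul hfderiv).integrable_of_hasCompactSupport (hsupp.fderiv_apply ℝ e).mul_left)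
    ((hinner.mul hf.continuous).integrable_of_hasCompactSupport hsupp.mul_left)
    (fun x _ => (innerSL ℝ e).differentiableAt) (fun x _ => hf.differentiable (by simp) x)
  simpa only [hone, one_mul, neg_neg] using congrArg Neg.neg hparts.symm

variable {D : ℕ} {Ω : Set (EuclideanSpace ℝ (Fin D))} {p : ℝ}

theorem abs_fderiv_norm_rpow_apply_le (hp : 1 < p) {φ : EuclideanSpace ℝ (Fin D) → ℝ}
    (hφ : Differentiable ℝ φ) {e : EuclideanSpace ℝ (Fin D)} (he : ‖e‖ = 1)
    (x : EuclideanSpace ℝ (Fin D)) :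
    |fderiv ℝ (fun x => ‖φ x‖ ^ p) x e| ≤ p * (‖φ x‖ ^ (p - 1) * ‖∇ φ x‖) := by
  have hgradient : ‖fderiv ℝ φ x‖ = ‖∇ φ x‖ := by simp [gradient]
  calc |fderiv ℝ (fun x => ‖φ x‖ ^ p) x e| ≤ ‖fderiv ℝ (fun x => ‖φ x‖ ^ p) x‖ * ‖e‖ :=
        (fderiv ℝ (fun x => ‖φ x‖ ^ p) x).le_opNorm e
    _ ≤ p * ‖φ x‖ ^ (p - 1) * ‖fderiv ℝ φ x‖ := by
        rw [he, mul_one]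
        exact norm_fderiv_norm_rpow_le hφ hp
    _ = p * (‖φ x‖ ^ (p - 1) * ‖∇ φ x‖) := by rw [hgradient, mul_assoc]

theorem IsTestFunction.integral_norm_rpow_le (hp : 1 < p) {e : EuclideanSpace ℝ (Fin D)}
    (he : ‖e‖ = 1) {M : ℝ} (hM : ∀ x ∈ Ω, |inner ℝ e x| ≤ M)
    {φ : EuclideanSpace ℝ (Fin D) → ℝ} (hφ : IsTestFunction Ω φ) :
    ∫ x in Ω, ‖φ x‖ ^ p ≤ p * M * ∫ x in Ω, ‖φ x‖ ^ (p - 1) * ‖∇ φ x‖ := by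
  have hp0 : 0 < p := by linarith
  set ψ : EuclideanSpace ℝ (Fin D) → ℝ := fun x => ‖φ x‖ ^ p
  have hψ : ContDiff ℝ 1 ψ := (hφ.smooth.of_le (by simp)).norm_rpow hp
  have hψsupp : HasCompactSupport ψ :=
    hφ.compact.comp_left (g := fun t : ℝ => ‖t‖ ^ p) (by simp [Real.zero_rpow hp0.ne'])
  have hψ_zero (x) (hx : x ∉ Ω) : ψ x = 0 := by
    simp [ψ, hφ.eq_zero_of_notMem hx, Real.zero_rpow hp0.ne']
  have hbound (x) := abs_fderiv_norm_rpow_apply_le hp hφ.differentiable he x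
  have hfderiv_zero (x) (hx : x ∉ Ω) : fderiv ℝ ψ x e = 0 := by
    have hle := hbound x
    rw [hφ.eq_zero_of_notMem hx, norm_zero, Real.zero_rpow (by linarith), zero_mul, mul_zero] at hle
    exact abs_nonpos_iff.1 hle
  have hpointwise (x) :
      ‖inner ℝ e x * fderiv ℝ ψ x e‖ ≤ p * M * (‖φ x‖ ^ (p - 1) * ‖∇ φ x‖) := by
    by_cases hx : x ∈ Ω
    · rw [norm_mul, Real.norm_eq_abs, Real.norm_eq_abs, mul_comm p M, mul_assoc]
      exact mul_le_mul (hM x hx) (hbound x) (abs_nonneg _) ((abs_nonneg _).trans (hM x hx))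
    · simp [hfderiv_zero x hx, hφ.eq_zero_of_notMem hx, Real.zero_rpow (sub_pos.2 hp).ne']
  calc ∫ x in Ω, ψ x = -∫ x in Ω, inner ℝ e x * fderiv ℝ ψ x e := by
        rw [setIntegral_eq_integral_of_forall_compl_eq_zero hψ_zero,
          setIntegral_eq_integral_of_forall_compl_eq_zero fun x hx => by
            rw [hfderiv_zero x hx, mul_zero],
          integral_eq_neg_integral_inner_mul_fderiv he hψ hψsupp]
    _ ≤ ‖∫ x in Ω, inner ℝ e x * fderiv ℝ ψ x e‖ := neg_le_abs _
    _ ≤ ∫ x in Ω, p * M * (‖φ x‖ ^ (p - 1) * ‖∇ φ x‖) :=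
        norm_integral_le_of_norm_le ((integrable_norm_rpow_sub_one_mul_norm hp (hφ.memLp _)
          (hφ.memLp_gradient _)).const_mul (p * M)) (.of_forall hpointwise)
    _ = p * M * ∫ x in Ω, ‖φ x‖ ^ (p - 1) * ‖∇ φ x‖ := integral_const_mul _ _

/-- `C` is a constant in the Poincaré inequality on `Ω`, stated for `p`-th powers of norms. -/
structure IsPoincareConstant (p : ℝ) (Ω : Set (EuclideanSpace ℝ (Fin D))) (C : ℝ) : Prop where
  nonneg : 0 ≤ C
  integral_le : ∀ φ, IsTestFunction Ω φ →
    ∫ x in Ω, ‖φ x‖ ^ p ≤ C * ∫ x in Ω, ‖∇ φ x‖ ^ p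

theorem isPoincareConstant_of_abs_inner_le (hp : 1 < p) {e : EuclideanSpace ℝ (Fin D)}
    (he : ‖e‖ = 1) {M : ℝ} (hM0 : 0 ≤ M) (hM : ∀ x ∈ Ω, |inner ℝ e x| ≤ M) :
    IsPoincareConstant p Ω ((p * M) ^ p) where
  nonneg := by positivity
  integral_le φ hφ := by
    refine le_rpow_mul_of_le_mul_rpow hp (by positivity) (integral_norm_rpow_nonneg _)
      (integral_norm_rpow_nonneg _) ((hφ.integral_norm_rpow_le hp he hM).trans ?_)
    gcongr
    exact integral_norm_rpow_sub_one_mul_norm_le hp (hφ.memLp _) (hφ.memLp_gradient _)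

end Poincare

section Energy

variable {D : ℕ} {Ω : Set (EuclideanSpace ℝ (Fin D))} {p C m : ℝ}
  {φ ψ : EuclideanSpace ℝ (Fin D) → ℝ}

/-- The `p`-torsion energy of a function `u` with gradient `G`. The gradient is a separate argument
so that the definition applies to weak gradients. -/
def energy (p : ℝ) (Ω : Set (EuclideanSpace ℝ (Fin D))) (u : EuclideanSpace ℝ (Fin D) → ℝ)
    (G : EuclideanSpace ℝ (Fin D) → EuclideanSpace ℝ (Fin D)) : ℝ :=
  (∫ x in Ω, ‖G x‖ ^ p) / p - ∫ x in Ω, u x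

theorem exists_mul_rpow_le (hp : 1 < p) (a : ℝ) :
    ∃ K, ∀ t : ℝ, 0 ≤ t → a * t ^ (1 / p) ≤ t / (2 * p) + K := by
  have hp0 : 0 < p := by linarith
  refine ⟨|a * 2 ^ (1 / p)| ^ p.conjExponent / p.conjExponent, fun t ht => ?_⟩
  have hyoung := Real.young_inequality ((t / 2) ^ (1 / p)) (a * 2 ^ (1 / p))
    (Real.HolderConjugate.conjExponent hp)
  have hpow : |(t / 2) ^ (1 / p)| ^ p = t / 2 := by
    rw [abs_of_nonneg (by positivity), ← Real.rpow_mul (by positivity),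
      one_div_mul_cancel hp0.ne', Real.rpow_one]
  calc a * t ^ (1 / p) = (t / 2) ^ (1 / p) * (a * 2 ^ (1 / p)) := by
        rw [Real.div_rpow ht zero_le_two]
        field_simp
    _ ≤ t / (2 * p) + |a * 2 ^ (1 / p)| ^ p.conjExponent / p.conjExponent := by
        rwa [hpow, div_div] at hyoung

theorem IsPoincareConstant.abs_integral_le (hC : IsPoincareConstant p Ω C) (hp : 1 < p)
    (hΩ : volume Ω ≠ ⊤) (hφ : IsTestFunction Ω φ) :
    |∫ x in Ω, φ x| ≤
      volume.real Ω ^ (1 - 1 / p) * C ^ (1 / p) * (∫ x in Ω, ‖∇ φ x‖ ^ p) ^ (1 / p) := by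
  have : Fact (volume Ω < ⊤) := ⟨hΩ.lt_top⟩
  have hholder := abs_integral_le_rpow hp (hφ.memLp (ENNReal.ofReal p))
  rw [measureReal_restrict_apply_univ] at hholder
  rw [mul_assoc, ← Real.mul_rpow hC.nonneg (integral_norm_rpow_nonneg _)]
  refine hholder.trans ?_
  gcongr
  exact hC.integral_le φ hφ

theorem IsPoincareConstant.exists_le_energy (hC : IsPoincareConstant p Ω C) (hp : 1 < p)
    (hΩ : volume Ω ≠ ⊤) :
    ∃ K, ∀ φ, IsTestFunction Ω φ →
      (∫ x in Ω, ‖∇ φ x‖ ^ p) / (2 * p) - K ≤ energy p Ω φ (∇ φ) := by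
  obtain ⟨K, hK⟩ := exists_mul_rpow_le hp (volume.real Ω ^ (1 - 1 / p) * C ^ (1 / p))
  refine ⟨K, fun φ hφ => ?_⟩
  have hlinear := (le_abs_self _).trans (hC.abs_integral_le hp hΩ hφ)
  have hyoung := hK _ (integral_norm_rpow_nonneg (μ := volume.restrict Ω) (p := p) (∇ φ))
  have hhalf (y : ℝ) : y / p = y / (2 * p) + y / (2 * p) := by field_simp; norm_num
  rw [energy, hhalf]
  linarith

theorem IsPoincareConstant.bddBelow_energy (hC : IsPoincareConstant p Ω C) (hp : 1 < p)
    (hΩ : volume Ω ≠ ⊤) : BddBelow ((fun φ => energy p Ω φ (∇ φ)) '' {φ | IsTestFunction Ω φ}) := by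
  obtain ⟨K, hK⟩ := hC.exists_le_energy hp hΩ
  refine ⟨-K, ?_⟩
  rintro _ ⟨φ, hφ, rfl⟩
  have hnonneg : 0 ≤ (∫ x in Ω, ‖∇ φ x‖ ^ p) / (2 * p) :=
    div_nonneg (integral_norm_rpow_nonneg _) (by linarith)
  linarith [hK φ hφ]

theorem integral_midpointDefect_gradient_le (hp : 1 < p)
    (hm : ∀ φ, IsTestFunction Ω φ → m ≤ energy p Ω φ (∇ φ)) (hφ : IsTestFunction Ω φ)
    (hψ : IsTestFunction Ω ψ) :
    ∫ x in Ω, midpointDefect p (∇ φ x) (∇ ψ x) ≤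
      p * ((energy p Ω φ (∇ φ) + energy p Ω ψ (∇ ψ)) / 2 - m) := by
  have hp0 : 0 < p := by linarith
  have hgradient : ∇ ((1 / 2 : ℝ) • (φ + ψ)) = fun x => (1 / 2 : ℝ) • (∇ φ x + ∇ ψ x) := by
    rw [(hφ.add hψ).gradient_smul, hφ.gradient_add hψ]
    rfl
  have hintegral : ∫ x in Ω, ((1 / 2 : ℝ) • (φ + ψ)) x =
      ((∫ x in Ω, φ x) + ∫ x in Ω, ψ x) / 2 := by
    simp only [Pi.smul_apply, Pi.add_apply, smul_eq_mul]
    rw [integral_const_mul, integral_add hφ.integrable hψ.integrable]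
    ring
  have hintφ := integrable_norm_rpow hp0 (hφ.memLp_gradient (ENNReal.ofReal p))
  have hintψ := integrable_norm_rpow hp0 (hψ.memLp_gradient (ENNReal.ofReal p))
  have hintmid := integrable_norm_rpow hp0
    (((hφ.add hψ).smul (1 / 2)).memLp_gradient (ENNReal.ofReal p))
  have hmid := hm _ ((hφ.add hψ).smul (1 / 2))
  simp only [hgradient] at hintmid
  have hintmean : Integrable (fun x => (‖∇ φ x‖ ^ p + ‖∇ ψ x‖ ^ p) / 2) (volume.restrict Ω) :=
    (hintφ.add hintψ).div_const 2
  rw [energy, hintegral, hgradient] at hmid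
  simp only [midpointDefect]
  rw [integral_sub hintmean hintmid, integral_div, integral_add hintφ hintψ, energy, energy]
  field_simp at hmid ⊢
  linarith

theorem IsPoincareConstant.exists_energy_lt_imp_integral_norm_gradient_le
    (hC : IsPoincareConstant p Ω C) (hp : 1 < p) (hΩ : volume Ω ≠ ⊤) (M : ℝ) :
    ∃ B > 0, ∀ φ, IsTestFunction Ω φ → energy p Ω φ (∇ φ) < M →
      ∫ x in Ω, ‖∇ φ x‖ ^ p ≤ B := by
  obtain ⟨K, hK⟩ := hC.exists_le_energy hp hΩ
  refine ⟨2 * p * (|M| + |K|) + 1, by positivity, fun φ hφ hlt => ?_⟩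
  have hquot : (∫ x in Ω, ‖∇ φ x‖ ^ p) / (2 * p) ≤ |M| + |K| := by
    linarith [hK φ hφ, le_abs_self M, le_abs_self K]
  rw [div_le_iff₀ (by positivity)] at hquot
  linarith

theorem IsPoincareConstant.exists_energy_lt_imp_integral_norm_sub_lt
    (hC : IsPoincareConstant p Ω C) (hp : 1 < p) (hΩ : volume Ω ≠ ⊤)
    (hm : ∀ φ, IsTestFunction Ω φ → m ≤ energy p Ω φ (∇ φ)) {ε : ℝ} (hε : 0 < ε) :
    ∃ δ > 0, ∀ φ ψ, IsTestFunction Ω φ → IsTestFunction Ω ψ →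
      energy p Ω φ (∇ φ) < m + δ → energy p Ω ψ (∇ ψ) < m + δ →
      ∫ x in Ω, ‖∇ φ x - ∇ ψ x‖ ^ p < ε := by
  have : 0 < p := by linarith
  obtain ⟨B, hB, hgradient_le⟩ := hC.exists_energy_lt_imp_integral_norm_gradient_le hp hΩ (m + 1)
  obtain ⟨C', hC', hconvex⟩ := exists_integral_norm_sub_rpow_le (μ := volume.restrict Ω)
    (F := EuclideanSpace ℝ (Fin D)) hp (ε := ε / (4 * B)) (by positivity)
  refine ⟨min 1 (ε / (4 * (C' * p + 1))), by positivity, fun φ ψ hφ hψ hφm hψm => ?_⟩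
  have hδ_one := min_le_left 1 (ε / (4 * (C' * p + 1)))
  have hδ_le := min_le_right 1 (ε / (4 * (C' * p + 1)))
  calc ∫ x in Ω, ‖∇ φ x - ∇ ψ x‖ ^ p
      ≤ ε / (4 * B) * ((∫ x in Ω, ‖∇ φ x‖ ^ p) + ∫ x in Ω, ‖∇ ψ x‖ ^ p) +
          C' * ∫ x in Ω, midpointDefect p (∇ φ x) (∇ ψ x) :=
        hconvex _ _ (hφ.memLp_gradient _) (hψ.memLp_gradient _)
    _ ≤ ε / (4 * B) * (B + B) + C' * (p * (ε / (4 * (C' * p + 1)))) := by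
        gcongr
        · exact hgradient_le φ hφ (by linarith)
        · exact hgradient_le ψ hψ (by linarith)
        · refine (integral_midpointDefect_gradient_le hp hm hφ hψ).trans ?_
          gcongr
          linarith
    _ < ε := by
        have hfrac : C' * (p * (ε / (4 * (C' * p + 1)))) < ε / 4 := by
          rw [← mul_assoc, mul_div_assoc', div_lt_div_iff₀ (by positivity) (by norm_num)]
          linarith [mul_pos hε zero_lt_four]
        have hhalf : ε / (4 * B) * (B + B) = ε / 2 := by field_simp; norm_num
        linarith

end Energy

section EulerLagrange

variable {α : Type*} [MeasurableSpace α] {μ : Measure α} {F : Type*} [NormedAddCommGroup F]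
  [InnerProductSpace ℝ F] {p : ℝ}

theorem norm_norm_rpow_sub_two_smul (hp : 1 < p) (v : F) :
    ‖‖v‖ ^ (p - 2) • v‖ = ‖v‖ ^ (p - 1) := by
  rw [norm_smul, Real.norm_of_nonneg (by positivity)]
  rcases eq_or_ne v 0 with rfl | hv
  · simp [Real.zero_rpow (by linarith : p - 1 ≠ 0)]
  · rw [← Real.rpow_add_one (norm_pos_iff.2 hv).ne']
    ring_nf

theorem abs_inner_norm_rpow_smul_le (hp : 1 < p) (v w : F) :
    |inner ℝ (‖v‖ ^ (p - 2) • v) w| ≤ ‖v‖ ^ (p - 1) * ‖w‖ := by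
  rw [← norm_norm_rpow_sub_two_smul hp]
  exact abs_real_inner_le_norm _ _

theorem inner_norm_rpow_smul_self (hp : 0 < p) (v : F) :
    inner ℝ (‖v‖ ^ (p - 2) • v) v = ‖v‖ ^ p := by
  rcases eq_or_ne v 0 with rfl | hv
  · simp [Real.zero_rpow hp.ne']
  · rw [inner_smul_left, real_inner_self_eq_norm_sq, conj_trivial, ← Real.rpow_natCast,
      ← Real.rpow_add (norm_pos_iff.2 hv), Nat.cast_two, sub_add_cancel]

theorem aestronglyMeasurable_norm_rpow_smul {G : α → F} (hG : AEStronglyMeasurable G μ) :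
    AEStronglyMeasurable (fun x => ‖G x‖ ^ (p - 2) • G x) μ :=
  (hG.norm.aemeasurable.pow_const (p - 2)).aestronglyMeasurable.smul hG

theorem memLp_norm_rpow_smul (hp : 1 < p) {G : α → F} (hG : MemLp G (ENNReal.ofReal p) μ) :
    MemLp (fun x => ‖G x‖ ^ (p - 2) • G x) (ENNReal.ofReal p.conjExponent) μ :=
  (memLp_norm_rpow_sub_one hp hG).congr_norm (aestronglyMeasurable_norm_rpow_smul hG.1)
    (.of_forall fun x => by
      rw [norm_norm_rpow_sub_two_smul hp, Real.norm_of_nonneg (by positivity)])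

theorem abs_integral_inner_norm_rpow_smul_le (hp : 1 < p) {G H : α → F}
    (hG : MemLp G (ENNReal.ofReal p) μ) (hH : MemLp H (ENNReal.ofReal p) μ) :
    |∫ x, inner ℝ (‖G x‖ ^ (p - 2) • G x) (H x) ∂μ| ≤
      (∫ x, ‖G x‖ ^ p ∂μ) ^ (1 - 1 / p) * (∫ x, ‖H x‖ ^ p ∂μ) ^ (1 / p) :=
  (norm_integral_le_of_norm_le (f := fun x => inner ℝ (‖G x‖ ^ (p - 2) • G x) (H x))
    (integrable_norm_rpow_sub_one_mul_norm hp hG hH)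
    (.of_forall fun _ => abs_inner_norm_rpow_smul_le hp _ _)).trans
      (integral_norm_rpow_sub_one_mul_norm_le hp hG hH)

theorem abs_inner_norm_rpow_smul_add_smul_le (hp : 1 < p) (v w : F) {t : ℝ} (ht : |t| ≤ 1) :
    |inner ℝ (‖v + t • w‖ ^ (p - 2) • (v + t • w)) w| ≤ (‖v‖ + ‖w‖) ^ p := by
  have hnorm : ‖v + t • w‖ ≤ ‖v‖ + ‖w‖ := by
    refine (norm_add_le _ _).trans ?_
    rw [norm_smul, Real.norm_eq_abs]
    linarith [mul_le_of_le_one_left (norm_nonneg w) ht]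
  calc |inner ℝ (‖v + t • w‖ ^ (p - 2) • (v + t • w)) w| ≤ ‖v + t • w‖ ^ (p - 1) * ‖w‖ :=
        abs_inner_norm_rpow_smul_le hp _ _
    _ ≤ (‖v‖ + ‖w‖) ^ (p - 1) * (‖v‖ + ‖w‖) ^ (1 : ℝ) := by
        rw [Real.rpow_one]
        gcongr
        exact le_add_of_nonneg_left (norm_nonneg v)
    _ = (‖v‖ + ‖w‖) ^ p := by
        rw [← Real.rpow_add_of_nonneg (by positivity) (by linarith) zero_le_one, sub_add_cancel]

theorem hasDerivAt_norm_add_smul_rpow (hp : 1 < p) (v w : F) (t : ℝ) :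
    HasDerivAt (fun t : ℝ => ‖v + t • w‖ ^ p)
      (p * inner ℝ (‖v + t • w‖ ^ (p - 2) • (v + t • w)) w) t := by
  have hline : HasDerivAt (fun t : ℝ => v + t • w) w t := by
    simpa using ((hasDerivAt_id t).smul_const w).const_add v
  refine ((hasFDerivAt_norm_rpow (v + t • w) hp).comp_hasDerivAt t hline).congr_deriv ?_
  rw [_root_.smul_apply, innerSL_apply_apply, real_inner_smul_left, smul_eq_mul, mul_assoc]

theorem hasDerivAt_integral_norm_add_smul_rpow (hp : 1 < p) {G H : α → F}
    (hG : MemLp G (ENNReal.ofReal p) μ) (hH : MemLp H (ENNReal.ofReal p) μ) :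
    HasDerivAt (fun t : ℝ => ∫ x, ‖G x + t • H x‖ ^ p ∂μ)
      (p * ∫ x, inner ℝ (‖G x‖ ^ (p - 2) • G x) (H x) ∂μ) 0 := by
  have hp0 : 0 < p := by linarith
  have hline (t : ℝ) : MemLp (fun x => G x + t • H x) (ENNReal.ofReal p) μ :=
    hG.add (hH.const_smul t)
  have hdominating : Integrable (fun x => p * (‖G x‖ + ‖H x‖) ^ p) μ := by
    refine ((integrable_norm_rpow hp0 (hG.norm.add hH.norm)).congr
      (.of_forall fun x => ?_)).const_mul p
    simp only [Pi.add_apply]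
    rw [Real.norm_of_nonneg (by positivity)]
  have hderiv := (hasDerivAt_integral_of_dominated_loc_of_deriv_le
    (F' := fun t x => p * inner ℝ (‖G x + t • H x‖ ^ (p - 2) • (G x + t • H x)) (H x))
    (Metric.ball_mem_nhds (0 : ℝ) one_pos)
    (.of_forall fun t => (integrable_norm_rpow hp0 (hline t)).1)
    (integrable_norm_rpow hp0 (hline 0))
    (((aestronglyMeasurable_norm_rpow_smul (hline 0).1).inner hH.1).const_mul p)
    (.of_forall fun x t ht => by
      rw [norm_mul, Real.norm_of_nonneg hp0.le]
      exact mul_le_mul_of_nonneg_left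
        (abs_inner_norm_rpow_smul_add_smul_le hp _ _ (mem_ball_zero_iff.1 ht).le) hp0.le)
    hdominating (.of_forall fun x t _ => hasDerivAt_norm_add_smul_rpow hp (G x) (H x) t)).2
  simpa only [zero_smul, add_zero, integral_const_mul] using hderiv

end EulerLagrange

section Existence

variable {D : ℕ} {Ω : Set (EuclideanSpace ℝ (Fin D))} {p C : ℝ}
  {u : EuclideanSpace ℝ (Fin D) → ℝ} {G : EuclideanSpace ℝ (Fin D) → EuclideanSpace ℝ (Fin D)}

theorem memW10_of_tendsto (hp : 1 < p) {φ : ℕ → EuclideanSpace ℝ (Fin D) → ℝ}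
    (hφ : ∀ n, IsTestFunction Ω (φ n)) (hu : MemLp u (ENNReal.ofReal p) (volume.restrict Ω))
    (hG : MemLp G (ENNReal.ofReal p) (volume.restrict Ω))
    (hφu : Tendsto (fun n => eLpNorm (fun x => φ n x - u x) (ENNReal.ofReal p)
      (volume.restrict Ω)) atTop (𝓝 0))
    (hφG : Tendsto (fun n => eLpNorm (fun x => ∇ (φ n) x - G x) (ENNReal.ofReal p)
      (volume.restrict Ω)) atTop (𝓝 0)) : MemW10 p Ω u G := by
  refine ⟨⟨hu, hG, fun ψ hψ => ?_⟩, φ, hφ, hφu, hφG⟩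
  have hleft := tendsto_integral_bilin hp (ContinuousLinearMap.lsmul ℝ ℝ)
    (fun n => (hφ n).memLp _) hu (hψ.memLp_gradient _) hφu
  have hright := tendsto_integral_bilin hp (ContinuousLinearMap.lsmul ℝ ℝ).flip
    (fun n => (hφ n).memLp_gradient _) hG (hψ.memLp _) hφG
  exact tendsto_nhds_unique hleft
    (hright.neg.congr fun n => ((hφ n).isWeakGradient ψ hψ).symm)

theorem MemW10.exists_tendsto [IsFiniteMeasure (volume.restrict Ω)] (hu : MemW10 p Ω u G)
    (hp : 1 < p) : ∃ φ : ℕ → EuclideanSpace ℝ (Fin D) → ℝ, (∀ n, IsTestFunction Ω (φ n)) ∧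
      Tendsto (fun n => ∫ x in Ω, φ n x) atTop (𝓝 (∫ x in Ω, u x)) ∧
      Tendsto (fun n => ∫ x in Ω, ‖∇ (φ n) x‖ ^ p) atTop (𝓝 (∫ x in Ω, ‖G x‖ ^ p)) := by
  obtain ⟨φ, hφ, hφu, hφG⟩ := hu.approx
  exact ⟨φ, hφ, tendsto_integral_of_tendsto_eLpNorm hp (fun n => (hφ n).memLp _) hu.memLp hφu,
    tendsto_integral_norm_rpow hp.le (fun n => (hφ n).memLp_gradient _) hu.memLp_grad hφG⟩

theorem MemW10.add_smul (hu : MemW10 p Ω u G) (hp : 1 < p) {ψ : EuclideanSpace ℝ (Fin D) → ℝ}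
    (hψ : IsTestFunction Ω ψ) (t : ℝ) : MemW10 p Ω (u + t • ψ) (G + t • ∇ ψ) := by
  obtain ⟨φ, hφ, hφu, hφG⟩ := hu.approx
  refine memW10_of_tendsto hp (fun n => (hφ n).add (hψ.smul t))
    (hu.memLp.add ((hψ.memLp _).const_smul t))
    (hu.memLp_grad.add ((hψ.memLp_gradient _).const_smul t)) ?_ ?_
  · simpa only [Pi.add_apply, add_sub_add_right_eq_sub] using hφu
  · simpa only [(hφ _).gradient_add (hψ.smul t), hψ.gradient_smul, Pi.add_apply,
      add_sub_add_right_eq_sub] using hφG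

theorem MemW10.le_energy [IsFiniteMeasure (volume.restrict Ω)] (hu : MemW10 p Ω u G) (hp : 1 < p)
    {m : ℝ} (hm : ∀ φ, IsTestFunction Ω φ → m ≤ energy p Ω φ (∇ φ)) : m ≤ energy p Ω u G := by
  obtain ⟨φ, hφ, hint, hgrad⟩ := hu.exists_tendsto hp
  exact ge_of_tendsto ((hgrad.div_const p).sub hint) (.of_forall fun n => hm _ (hφ n))

theorem IsPoincareConstant.exists_memW10_of_cauchy (hC : IsPoincareConstant p Ω C) (hp : 1 < p)
    {φ : ℕ → EuclideanSpace ℝ (Fin D) → ℝ} (hφ : ∀ n, IsTestFunction Ω (φ n))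
    (hcauchy : ∀ ε > 0, ∃ N, ∀ k ≥ N, ∀ l ≥ N, ∫ x in Ω, ‖∇ (φ k) x - ∇ (φ l) x‖ ^ p < ε) :
    ∃ u G, MemW10 p Ω u G ∧
      Tendsto (fun n => eLpNorm (fun x => φ n x - u x) (ENNReal.ofReal p)
        (volume.restrict Ω)) atTop (𝓝 0) ∧
      Tendsto (fun n => eLpNorm (fun x => ∇ (φ n) x - G x) (ENNReal.ofReal p)
        (volume.restrict Ω)) atTop (𝓝 0) := by
  have hcauchy' : ∀ ε > 0, ∃ N, ∀ k ≥ N, ∀ l ≥ N, ∫ x in Ω, ‖φ k x - φ l x‖ ^ p < ε := by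
    intro ε hε
    have hC0 := hC.nonneg
    obtain ⟨N, hN⟩ := hcauchy (ε / (C + 1)) (by positivity)
    refine ⟨N, fun k hk l hl => ?_⟩
    have hpoincare := hC.integral_le _ ((hφ k).add ((hφ l).smul (-1)))
    rw [(hφ k).gradient_add ((hφ l).smul (-1)), (hφ l).gradient_smul] at hpoincare
    simp only [Pi.add_apply, neg_smul, one_smul, Pi.neg_apply, ← sub_eq_add_neg] at hpoincare
    have hgrad := hN k hk l hl
    rw [lt_div_iff₀ (by positivity)] at hgrad
    linarith [integral_norm_rpow_nonneg (μ := volume.restrict Ω) (p := p) fun x =>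
      ∇ (φ k) x - ∇ (φ l) x]
  obtain ⟨u, hu, hφu⟩ := exists_memLp_limit hp.le (fun n => (hφ n).memLp _) hcauchy'
  obtain ⟨G, hG, hφG⟩ := exists_memLp_limit hp.le (fun n => (hφ n).memLp_gradient _) hcauchy
  exact ⟨u, G, memW10_of_tendsto hp hφ hu hG hφu hφG, hφu, hφG⟩

theorem IsPoincareConstant.exists_memW10_energy_le (hC : IsPoincareConstant p Ω C) (hp : 1 < p)
    (hΩ : volume Ω ≠ ⊤) : ∃ u G, MemW10 p Ω u G ∧
      ∀ φ, IsTestFunction Ω φ → energy p Ω u G ≤ energy p Ω φ (∇ φ) := by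
  have : IsFiniteMeasure (volume.restrict Ω) := isFiniteMeasure_restrict.2 hΩ
  set S := (fun φ => energy p Ω φ (∇ φ)) '' {φ | IsTestFunction Ω φ}
  have hbdd : BddBelow S := hC.bddBelow_energy hp hΩ
  have hm (φ) (hφ : IsTestFunction Ω φ) : sInf S ≤ energy p Ω φ (∇ φ) :=
    csInf_le hbdd (mem_image_of_mem _ hφ)
  obtain ⟨e, -, he, heS⟩ :=
    exists_seq_tendsto_sInf ⟨_, mem_image_of_mem _ IsTestFunction.zero⟩ hbdd
  choose φ hφ hφe using heS
  obtain rfl : (fun n => energy p Ω (φ n) (∇ (φ n))) = e := funext hφe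
  obtain ⟨u, G, hu, hφu, hφG⟩ := hC.exists_memW10_of_cauchy hp hφ fun ε hε => by
    obtain ⟨δ, hδ, hclose⟩ := hC.exists_energy_lt_imp_integral_norm_sub_lt hp hΩ hm hε
    obtain ⟨N, hN⟩ := eventually_atTop.1 (he.eventually (gt_mem_nhds (lt_add_of_pos_right _ hδ)))
    exact ⟨N, fun k hk l hl => hclose _ _ (hφ k) (hφ l) (hN k hk) (hN l hl)⟩
  have hlim : energy p Ω u G = sInf S := tendsto_nhds_unique
    (((tendsto_integral_norm_rpow hp.le (fun n => (hφ n).memLp_gradient _) hu.memLp_grad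
      hφG).div_const p).sub (tendsto_integral_of_tendsto_eLpNorm hp (fun n => (hφ n).memLp _)
        hu.memLp hφu)) he
  exact ⟨u, G, hu, fun φ hφ => hlim.trans_le (hm φ hφ)⟩

theorem MemW10.isTorsionFunction_of_energy_le [IsFiniteMeasure (volume.restrict Ω)]
    (hu : MemW10 p Ω u G) (hp : 1 < p)
    (hmin : ∀ φ, IsTestFunction Ω φ → energy p Ω u G ≤ energy p Ω φ (∇ φ)) :
    IsTorsionFunction p Ω u := by
  refine ⟨G, hu, fun ψ hψ => ?_⟩
  have henergy (t : ℝ) : energy p Ω (u + t • ψ) (G + t • ∇ ψ) =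
      (∫ x in Ω, ‖G x + t • ∇ ψ x‖ ^ p) / p - ((∫ x in Ω, u x) + t * ∫ x in Ω, ψ x) := by
    have hintu : Integrable u (volume.restrict Ω) := hu.memLp.integrable (by simpa using hp.le)
    simp only [energy, Pi.add_apply, Pi.smul_apply, smul_eq_mul]
    rw [integral_add hintu (hψ.integrable.const_mul t), integral_const_mul]
  have hderiv : HasDerivAt (fun t : ℝ => energy p Ω (u + t • ψ) (G + t • ∇ ψ))
      ((p * ∫ x in Ω, inner ℝ (‖G x‖ ^ (p - 2) • G x) (∇ ψ x)) / p - 1 * ∫ x in Ω, ψ x) 0 := by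
    simp only [henergy]
    exact ((hasDerivAt_integral_norm_add_smul_rpow hp hu.memLp_grad
      (hψ.memLp_gradient _)).div_const p).sub (((hasDerivAt_id 0).mul_const _).const_add _)
  have hloc : IsLocalMin (fun t : ℝ => energy p Ω (u + t • ψ) (G + t • ∇ ψ)) 0 :=
    .of_forall fun t => by
      simpa only [zero_smul, add_zero] using (hu.add_smul hp hψ t).le_energy hp hmin
  have hzero := hloc.hasDerivAt_eq_zero hderiv
  rw [mul_div_cancel_left₀ _ (by linarith), one_mul] at hzero
  exact sub_eq_zero.1 hzero

theorem IsPoincareConstant.exists_isTorsionFunction (hC : IsPoincareConstant p Ω C) (hp : 1 < p)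
    (hΩ : volume Ω ≠ ⊤) : ∃ u, IsTorsionFunction p Ω u := by
  have : IsFiniteMeasure (volume.restrict Ω) := isFiniteMeasure_restrict.2 hΩ
  obtain ⟨u, G, hu, hmin⟩ := hC.exists_memW10_energy_le hp hΩ
  exact ⟨u, hu.isTorsionFunction_of_energy_le hp hmin⟩

end Existence

section TorsionBounds

variable {D : ℕ} {Ω : Set (EuclideanSpace ℝ (Fin D))} [IsFiniteMeasure (volume.restrict Ω)]
  {p : ℝ} {u : EuclideanSpace ℝ (Fin D) → ℝ}

theorem IsTorsionFunction.exists_integral_inner_eq (hu : IsTorsionFunction p Ω u) (hp : 1 < p) :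
    ∃ G, MemW10 p Ω u G ∧ ∀ v H, MemW10 p Ω v H →
      ∫ x in Ω, inner ℝ (‖G x‖ ^ (p - 2) • G x) (H x) = ∫ x in Ω, v x := by
  obtain ⟨G, hG, hweak⟩ := hu
  refine ⟨G, hG, fun v H hv => ?_⟩
  obtain ⟨φ, hφ, hφv, hφH⟩ := hv.approx
  have hflux := tendsto_integral_bilin hp (innerSL ℝ).flip (fun n => (hφ n).memLp_gradient _)
    hv.memLp_grad (memLp_norm_rpow_smul hp hG.memLp_grad) hφH
  simp only [ContinuousLinearMap.flip_apply, innerSL_apply_apply, hweak _ (hφ _)] at hflux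
  exact tendsto_nhds_unique hflux
    (tendsto_integral_of_tendsto_eLpNorm hp (fun n => (hφ n).memLp _) hv.memLp hφv)

theorem IsTorsionFunction.integral_nonneg (hu : IsTorsionFunction p Ω u) (hp : 1 < p) :
    0 ≤ ∫ x in Ω, u x := by
  obtain ⟨G, hG, hweak⟩ := hu.exists_integral_inner_eq hp
  rw [← hweak u G hG]
  simp only [inner_norm_rpow_smul_self (by linarith : 0 < p)]
  exact integral_norm_rpow_nonneg G

theorem IsTorsionFunction.integral_le_rpow_mul_rpow (hu : IsTorsionFunction p Ω u) (hp : 1 < p)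
    {v : EuclideanSpace ℝ (Fin D) → ℝ}
    {H : EuclideanSpace ℝ (Fin D) → EuclideanSpace ℝ (Fin D)} (hv : MemW10 p Ω v H) :
    ∫ x in Ω, v x ≤ (∫ x in Ω, u x) ^ (1 - 1 / p) * (∫ x in Ω, ‖H x‖ ^ p) ^ (1 / p) := by
  obtain ⟨G, hG, hweak⟩ := hu.exists_integral_inner_eq hp
  have henergy := hweak u G hG
  simp only [inner_norm_rpow_smul_self (by linarith : 0 < p)] at henergy
  rw [← hweak v H hv, ← henergy]
  exact (le_abs_self _).trans (abs_integral_inner_norm_rpow_smul_le hp hG.memLp_grad hv.memLp_grad)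

theorem IsTorsionFunction.integral_le (hu : IsTorsionFunction p Ω u) (hp : 1 < p) {C : ℝ}
    (hC : 0 ≤ C) (h : ∀ φ, IsTestFunction Ω φ →
      ∫ x in Ω, φ x ≤ C ^ (1 - 1 / p) * (∫ x in Ω, ‖∇ φ x‖ ^ p) ^ (1 / p)) :
    ∫ x in Ω, u x ≤ C := by
  have hp0 : 0 < p := by linarith
  obtain ⟨G, hG, hweak⟩ := hu.exists_integral_inner_eq hp
  have henergy := hweak u G hG
  simp only [inner_norm_rpow_smul_self hp0] at henergy
  obtain ⟨φ, hφ, hint, hgrad⟩ := hG.exists_tendsto hp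
  have hlimit := le_of_tendsto_of_tendsto' hint
    ((hgrad.rpow_const (p := 1 / p) (Or.inr (by positivity))).const_mul (C ^ (1 - 1 / p)))
    fun n => h _ (hφ n)
  rw [henergy] at hlimit
  set I := ∫ x in Ω, u x
  by_contra! hlt
  have hI : 0 < I := hC.trans_lt hlt
  have hexp : 0 < 1 - 1 / p := by rwa [sub_pos, div_lt_one hp0]
  have hstrict : C ^ (1 - 1 / p) * I ^ (1 / p) < I := by
    calc C ^ (1 - 1 / p) * I ^ (1 / p) < I ^ (1 - 1 / p) * I ^ (1 / p) := by gcongr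
      _ = I := by rw [← Real.rpow_add hI, sub_add_cancel, Real.rpow_one]
  exact hlimit.not_gt hstrict

end TorsionBounds

section Subgraph

variable {α : Type*} [MeasurableSpace α] {ν : Measure α} {S : Set (α × ℝ)} {R : ℝ}

/-- `S` is the region below the graph of some function `α → [0, R]`: a measurable set of points
`(s, t)` with `0 < t ≤ R` that contains, with each point, the vertical segment below it. -/
structure IsSubgraph (S : Set (α × ℝ)) (R : ℝ) : Prop where
  nonneg : 0 ≤ R
  measurableSet : MeasurableSet S
  mem_Ioc : ∀ s t, (s, t) ∈ S → t ∈ Ioc 0 R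
  mem_of_le : ∀ s t t', (s, t) ∈ S → 0 < t' → t' ≤ t → (s, t') ∈ S

/-- The length of the vertical section of `S` over `s`; for a subgraph this recovers the function
whose graph bounds `S`. -/
def sectionLength (S : Set (α × ℝ)) (s : α) : ℝ := volume.real (Prod.mk s ⁻¹' S)

omit [MeasurableSpace α] in
theorem sectionLength_nonneg (s : α) : 0 ≤ sectionLength S s := measureReal_nonneg

theorem measurable_sectionLength (hS : MeasurableSet S) : Measurable (sectionLength S) :=
  (measurable_measure_prodMk_left hS).ennreal_toReal

theorem integrable_sectionLength [SFinite ν] (hS : MeasurableSet S)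
    (hv : ν.prod volume S ≠ ⊤) : Integrable (sectionLength S) ν :=
  Measure.integrable_measure_prodMk_left hS hv

namespace IsSubgraph

theorem sectionLength_le (h : IsSubgraph S R) (s : α) : sectionLength S s ≤ R := by
  calc sectionLength S s ≤ volume.real (Ioc 0 R) :=
        measureReal_mono (fun t => h.mem_Ioc s t) measure_Ioc_lt_top.ne
    _ = R := by rw [Real.volume_real_Ioc_of_le h.nonneg, sub_zero]

theorem le_sectionLength (h : IsSubgraph S R) {s : α} {t : ℝ} (hst : (s, t) ∈ S) :
    t ≤ sectionLength S s := by
  calc t = volume.real (Ioc 0 t) := by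
        rw [Real.volume_real_Ioc_of_le (h.mem_Ioc s t hst).1.le, sub_zero]
    _ ≤ sectionLength S s := measureReal_mono (fun t' ht' => h.mem_of_le s t t' hst ht'.1 ht'.2)
        ((measure_mono fun t => h.mem_Ioc s t).trans_lt measure_Ioc_lt_top).ne

theorem mem_of_lt_sectionLength (h : IsSubgraph S R) {s : α} {t : ℝ} (ht : 0 < t)
    (hts : t < sectionLength S s) : (s, t) ∈ S := by
  by_contra hst
  have hsub : Prod.mk s ⁻¹' S ⊆ Ioc 0 t := fun t' ht' =>
    ⟨(h.mem_Ioc s t' ht').1, not_lt.1 fun hlt => hst (h.mem_of_le s t' t ht' ht hlt.le)⟩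
  have hle : sectionLength S s ≤ volume.real (Ioc 0 t) :=
    measureReal_mono hsub measure_Ioc_lt_top.ne
  rw [Real.volume_real_Ioc_of_le ht.le, sub_zero] at hle
  exact hle.not_gt hts

theorem sub_mem_Icc (h : IsSubgraph S R) {z : α × ℝ} (hz : z ∈ S) :
    sectionLength S z.1 - z.2 ∈ Icc 0 R :=
  ⟨sub_nonneg.2 (h.le_sectionLength hz), by
    linarith [h.sectionLength_le z.1, (h.mem_Ioc z.1 z.2 hz).1]⟩

theorem measurable_sub (h : IsSubgraph S R) :
    Measurable fun z : α × ℝ => sectionLength S z.1 - z.2 :=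
  ((measurable_sectionLength h.measurableSet).comp measurable_fst).sub measurable_snd

theorem memLp_sub [SFinite ν] (h : IsSubgraph S R) (hv : ν.prod volume S ≠ ⊤) (q : ℝ≥0∞) :
    MemLp (fun z : α × ℝ => sectionLength S z.1 - z.2) q ((ν.prod volume).restrict S) := by
  have : IsFiniteMeasure ((ν.prod volume).restrict S) := isFiniteMeasure_restrict.2 hv
  refine .of_bound h.measurable_sub.aestronglyMeasurable R
    (ae_restrict_of_forall_mem h.measurableSet fun z hz => ?_)
  rw [Real.norm_of_nonneg (h.sub_mem_Icc hz).1]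
  exact (h.sub_mem_Icc hz).2

theorem setIntegral_section (h : IsSubgraph S R) (s : α) (g : ℝ → ℝ) :
    ∫ t in Prod.mk s ⁻¹' S, g t = ∫ t in (0)..sectionLength S s, g t := by
  have hlower : Ioo 0 (sectionLength S s) ⊆ Prod.mk s ⁻¹' S := fun t ht =>
    h.mem_of_lt_sectionLength ht.1 ht.2
  have hupper : Prod.mk s ⁻¹' S ⊆ Ioc 0 (sectionLength S s) := fun t ht =>
    ⟨(h.mem_Ioc s t ht).1, h.le_sectionLength ht⟩
  rw [intervalIntegral.integral_of_le (sectionLength_nonneg s)]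
  exact setIntegral_congr_set (hupper.eventuallyLE.antisymm
    (Ioo_ae_eq_Ioc.symm.le.trans hlower.eventuallyLE))

variable [SFinite ν]

theorem setIntegral_eq (h : IsSubgraph S R) {f : α × ℝ → ℝ}
    (hf : IntegrableOn f S (ν.prod volume)) :
    ∫ z in S, f z ∂ν.prod volume = ∫ s, (∫ t in (0)..sectionLength S s, f (s, t)) ∂ν := by
  rw [← integral_indicator h.measurableSet,
    integral_prod _ (hf.integrable_indicator h.measurableSet)]
  refine integral_congr_ae (.of_forall fun s => ?_)
  exact (integral_indicator (measurable_prodMk_left h.measurableSet)).trans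
    (h.setIntegral_section s fun t => f (s, t))

theorem measureReal_eq (h : IsSubgraph S R) (hv : ν.prod volume S ≠ ⊤) :
    (ν.prod volume).real S = ∫ s, sectionLength S s ∂ν := by
  simpa using h.setIntegral_eq (f := fun _ => 1) (integrableOn_const hv)

/-- Integration by parts on the vertical sections, where `∂f/∂t = f'` and `f` vanishes at the
bottom: the factor `sectionLength S s - t` vanishes at the top. -/
theorem setIntegral_eq_integral_sub_mul_deriv (h : IsSubgraph S R) (hv : ν.prod volume S ≠ ⊤)
    {f f' : α × ℝ → ℝ} (hf : Measurable f) (hf' : Measurable f')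
    (hcont : ∀ s, Continuous fun t => f' (s, t))
    (hderiv : ∀ s t, HasDerivAt (fun t => f (s, t)) (f' (s, t)) t) (hzero : ∀ s, f (s, 0) = 0)
    {C C' : ℝ} (hC : ∀ z, |f z| ≤ C) (hC' : ∀ z, |f' z| ≤ C') :
    ∫ z in S, f z ∂ν.prod volume =
      ∫ z in S, (sectionLength S z.1 - z.2) * f' z ∂ν.prod volume := by
  have hint : IntegrableOn f S (ν.prod volume) :=
    Measure.integrableOn_of_bounded hv hf.aestronglyMeasurable (.of_forall hC)
  have hint' : IntegrableOn (fun z => (sectionLength S z.1 - z.2) * f' z) S (ν.prod volume) := by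
    refine Measure.integrableOn_of_bounded (M := R * C') hv
      (h.measurable_sub.mul hf').aestronglyMeasurable
      (ae_restrict_of_forall_mem h.measurableSet fun z hz => ?_)
    rw [norm_mul, Real.norm_of_nonneg (h.sub_mem_Icc hz).1]
    exact mul_le_mul (h.sub_mem_Icc hz).2 (hC' z) (norm_nonneg _) h.nonneg
  rw [h.setIntegral_eq hint, h.setIntegral_eq hint']
  refine integral_congr_ae (.of_forall fun s => ?_)
  have hparts := intervalIntegral.integral_mul_deriv_eq_deriv_mul (a := 0)
    (b := sectionLength S s) (fun t _ => (hasDerivAt_id t).const_sub (sectionLength S s))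
    (fun t _ => hderiv s t) intervalIntegrable_const ((hcont s).intervalIntegrable _ _)
  simpa [hzero] using hparts.symm

theorem setIntegral_sub_rpow_le (h : IsSubgraph S R) (hv : ν.prod volume S ≠ ⊤) {q : ℝ}
    (hq : 0 < q) : ∫ z in S, (sectionLength S z.1 - z.2) ^ q ∂ν.prod volume ≤
      R ^ q * (ν.prod volume).real S / (q + 1) := by
  have hint : IntegrableOn (fun z => (sectionLength S z.1 - z.2) ^ q) S (ν.prod volume) := by
    refine Measure.integrableOn_of_bounded (M := R ^ q) hv
      (h.measurable_sub.pow_const q).aestronglyMeasurable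
      (ae_restrict_of_forall_mem h.measurableSet fun z hz => ?_)
    obtain ⟨hsub, hle⟩ := h.sub_mem_Icc hz
    rw [Real.norm_of_nonneg (by positivity)]
    gcongr
  have hsection (s : α) : ∫ t in (0)..sectionLength S s, (sectionLength S s - t) ^ q =
      sectionLength S s ^ (q + 1) / (q + 1) := by
    rw [intervalIntegral.integral_comp_sub_left (fun t => t ^ q), sub_self, sub_zero,
      integral_rpow (Or.inl (by linarith)), Real.zero_rpow (by linarith), sub_zero]
  have hbound (s : α) : sectionLength S s ^ (q + 1) ≤ R ^ q * sectionLength S s := by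
    have hnonneg := sectionLength_nonneg (S := S) s
    rw [Real.rpow_add_one' hnonneg (by linarith)]
    gcongr
    exact h.sectionLength_le s
  rw [h.setIntegral_eq hint, h.measureReal_eq hv]
  simp only [hsection, integral_div]
  rw [← integral_const_mul]
  refine div_le_div_of_nonneg_right ?_ (by linarith)
  exact integral_mono_of_nonneg (.of_forall fun s => Real.rpow_nonneg (sectionLength_nonneg s) _)
    ((integrable_sectionLength h.measurableSet hv).const_mul _) (.of_forall hbound)

theorem setIntegral_le (h : IsSubgraph S R) (hv : ν.prod volume S ≠ ⊤)
    {f f' : α × ℝ → ℝ} (hf : Measurable f) (hf' : Measurable f')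
    (hcont : ∀ s, Continuous fun t => f' (s, t))
    (hderiv : ∀ s t, HasDerivAt (fun t => f (s, t)) (f' (s, t)) t) (hzero : ∀ s, f (s, 0) = 0)
    {C C' : ℝ} (hC : ∀ z, |f z| ≤ C) (hC' : ∀ z, |f' z| ≤ C') {p q : ℝ}
    (hpq : p.HolderConjugate q) :
    ∫ z in S, f z ∂ν.prod volume ≤ (R ^ q * (ν.prod volume).real S / (q + 1)) ^ (1 / q) *
      (∫ z in S, |f' z| ^ p ∂ν.prod volume) ^ (1 / p) := by
  have : IsFiniteMeasure ((ν.prod volume).restrict S) := isFiniteMeasure_restrict.2 hv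
  have hq := hpq.symm.pos
  have hnonneg (z) (hz : z ∈ S) := (h.sub_mem_Icc hz).1
  have hmemLp' : MemLp f' (ENNReal.ofReal p) ((ν.prod volume).restrict S) :=
    .of_bound hf'.aestronglyMeasurable C' (.of_forall hC')
  rw [h.setIntegral_eq_integral_sub_mul_deriv hv hf hf' hcont hderiv hzero hC hC']
  calc ∫ z in S, (sectionLength S z.1 - z.2) * f' z ∂ν.prod volume
      ≤ ∫ z in S, ‖sectionLength S z.1 - z.2‖ * ‖f' z‖ ∂ν.prod volume := by
        simp only [← norm_mul]
        exact (Real.le_norm_self _).trans (norm_integral_le_integral_norm _)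
    _ ≤ (∫ z in S, ‖sectionLength S z.1 - z.2‖ ^ q ∂ν.prod volume) ^ (1 / q) *
          (∫ z in S, ‖f' z‖ ^ p ∂ν.prod volume) ^ (1 / p) :=
        integral_mul_norm_le_Lp_mul_Lq hpq.symm (h.memLp_sub hv _) hmemLp'
    _ = (∫ z in S, (sectionLength S z.1 - z.2) ^ q ∂ν.prod volume) ^ (1 / q) *
          (∫ z in S, |f' z| ^ p ∂ν.prod volume) ^ (1 / p) := by
        rw [setIntegral_congr_fun h.measurableSet fun z hz => by
          rw [Real.norm_of_nonneg (hnonneg z hz)]]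
        simp only [Real.norm_eq_abs]
    _ ≤ (R ^ q * (ν.prod volume).real S / (q + 1)) ^ (1 / q) *
          (∫ z in S, |f' z| ^ p ∂ν.prod volume) ^ (1 / p) := by
        gcongr
        · exact setIntegral_nonneg h.measurableSet fun z hz =>
            Real.rpow_nonneg (hnonneg z hz) q
        · exact h.setIntegral_sub_rpow_le hv hq

end IsSubgraph

end Subgraph

section OrthogonalCoordinates

variable {E : Type*} [NormedAddCommGroup E] [InnerProductSpace ℝ E] [FiniteDimensional ℝ E]
  [MeasurableSpace E] [BorelSpace E]

theorem exists_measurePreserving_orthogonal_prod {v : E} (hv : ‖v‖ = 1) (x₀ : E) :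
    ∃ e : (ℝ ∙ v)ᗮ × ℝ ≃ᵐ E, MeasurePreserving e ∧ ∀ z, e z = x₀ + z.1 + z.2 • v := by
  set line := LinearIsometryEquiv.toSpanUnitSingleton (𝕜 := ℝ) v hv
  refine ⟨(MeasurableEquiv.prodComm.trans
    (line.toMeasurableEquiv.prodCongr (.refl _))).trans ((ℝ ∙ v).measurableEquivProd x₀).symm,
    ?_, fun z => ?_⟩
  · have hdecomposition := ((ℝ ∙ v).measurePreserving_measurableEquivProd x₀).symm
    rw [InnerProductSpace.euclideanHausdorffMeasure_eq_volume] at hdecomposition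
    exact hdecomposition.comp
      ((line.measurePreserving.prod (.id volume)).comp Measure.measurePreserving_swap)
  · change ((ℝ ∙ v).measurableEquivProd x₀).symm (line z.2, z.1) = _
    rw [Submodule.measurableEquivProd_symm_apply, LinearIsometryEquiv.toSpanUnitSingleton_apply,
      vadd_eq_add]
    abel

end OrthogonalCoordinates

section Circumscribed

/-- `T` is a polytope circumscribed about a ball: it is bounded, and it is cut out by the tangent
hyperplanes with the distinct unit outer normals `n i` of the ball with centre `c` and
radius `R`. -/
structure IsCircumscribed {D : ℕ} {ι : Type*} (T : Set (EuclideanSpace ℝ (Fin D)))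
    (n : ι → EuclideanSpace ℝ (Fin D)) (c : EuclideanSpace ℝ (Fin D)) (R : ℝ) : Prop where
  pos : 0 < R
  norm_eq : ∀ i, ‖n i‖ = 1
  injective : Function.Injective n
  mem_iff : ∀ x, x ∈ T ↔ ∀ i, inner ℝ (n i) (x - c) < R
  isBounded : Bornology.IsBounded T

/-- The points of the polytope with incentre `c` and outer normals `n` whose nearest face is the
`i`-th one. -/
def nearestFace {D : ℕ} {ι : Type*} (T : Set (EuclideanSpace ℝ (Fin D)))
    (n : ι → EuclideanSpace ℝ (Fin D)) (c : EuclideanSpace ℝ (Fin D)) (i : ι) :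
    Set (EuclideanSpace ℝ (Fin D)) :=
  {x | x ∈ T ∧ ∀ j, inner ℝ (n j) (x - c) ≤ inner ℝ (n i) (x - c)}

variable {D : ℕ} {ι : Type*} {T : Set (EuclideanSpace ℝ (Fin D))}
  {n : ι → EuclideanSpace ℝ (Fin D)} {c : EuclideanSpace ℝ (Fin D)} {R : ℝ}

theorem sum_rpow_mul_rpow_le [Fintype ι] {p q : ℝ} (hpq : p.HolderConjugate q) {f g : ι → ℝ}
    (hf : ∀ i, 0 ≤ f i) (hg : ∀ i, 0 ≤ g i) :
    ∑ i, f i ^ (1 / p) * g i ^ (1 / q) ≤ (∑ i, f i) ^ (1 / p) * (∑ i, g i) ^ (1 / q) := by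
  have hf' (i) : (f i ^ (1 / p)) ^ p = f i := by
    rw [one_div, Real.rpow_inv_rpow (hf i) hpq.ne_zero]
  have hg' (i) : (g i ^ (1 / q)) ^ q = g i := by
    rw [one_div, Real.rpow_inv_rpow (hg i) hpq.symm.ne_zero]
  simpa only [hf', hg'] using Real.inner_le_Lp_mul_Lq_of_nonneg Finset.univ hpq
    (fun i _ => Real.rpow_nonneg (hf i) (1 / p)) fun i _ => Real.rpow_nonneg (hg i) (1 / q)

theorem iUnion_nearestFace [Finite ι] [Nonempty ι] (T : Set (EuclideanSpace ℝ (Fin D)))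
    (n : ι → EuclideanSpace ℝ (Fin D)) (c : EuclideanSpace ℝ (Fin D)) :
    ⋃ i, nearestFace T n c i = T := by
  ext x
  simp only [mem_iUnion]
  refine ⟨fun ⟨i, hi⟩ => hi.1, fun hx => ?_⟩
  obtain ⟨i, hi⟩ := Finite.exists_max fun j => inner ℝ (n j) (x - c)
  exact ⟨i, hx, hi⟩

namespace IsCircumscribed

theorem volume_ne_top (h : IsCircumscribed T n c R) : volume T ≠ ⊤ :=
  h.isBounded.measure_lt_top.ne

theorem center_mem (h : IsCircumscribed T n c R) : c ∈ T := by
  simp [h.mem_iff, h.pos]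

theorem abs_inner_normal_le (h : IsCircumscribed T n c R) (i : ι)
    (y : EuclideanSpace ℝ (Fin D)) : |inner ℝ (n i) y| ≤ ‖y‖ := by
  simpa [h.norm_eq] using abs_real_inner_le_norm (n i) y

theorem abs_inner_neg_normal_le (h : IsCircumscribed T n c R) (i : ι)
    (y : EuclideanSpace ℝ (Fin D)) : |inner ℝ y (-n i)| ≤ ‖y‖ := by
  simpa [real_inner_comm] using h.abs_inner_normal_le i y

theorem inner_normal_self (h : IsCircumscribed T n c R) (i : ι) :
    inner ℝ (n i) (n i) = (1 : ℝ) := by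
  simp [h.norm_eq]

theorem inner_normal_le_one (h : IsCircumscribed T n c R) (i j : ι) :
    inner ℝ (n i) (n j) ≤ (1 : ℝ) := by
  simpa [h.norm_eq] using real_inner_le_norm (n i) (n j)

theorem exists_inner_nonneg [Nonempty ι] (h : IsCircumscribed T n c R)
    (y : EuclideanSpace ℝ (Fin D)) : ∃ i, 0 ≤ inner ℝ (n i) y := by
  by_contra! hneg
  have hy : 0 < ‖y‖ := by
    obtain ⟨i⟩ := ‹Nonempty ι›
    exact norm_pos_iff.2 fun hy => (hneg i).ne (by simp [hy])
  have hray (s : ℝ) (hs : 0 ≤ s) : c + s • y ∈ T := (h.mem_iff _).2 fun i => by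
    rw [add_sub_cancel_left, inner_smul_right]
    exact (mul_nonpos_of_nonneg_of_nonpos hs (hneg i).le).trans_lt h.pos
  obtain ⟨M, hM⟩ := h.isBounded.subset_closedBall c
  have hM0 : 0 ≤ M := dist_nonneg.trans (hM h.center_mem)
  have hmem := hM (hray ((M + 1) / ‖y‖) (by positivity))
  rw [Metric.mem_closedBall, dist_self_add_left, norm_smul, Real.norm_of_nonneg (by positivity),
    div_mul_cancel₀ _ hy.ne'] at hmem
  linarith

theorem nontrivial [Nonempty ι] (h : IsCircumscribed T n c R) : Nontrivial ι := by
  obtain ⟨i⟩ := ‹Nonempty ι›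
  obtain ⟨j, hj⟩ := h.exists_inner_nonneg (-n i)
  refine ⟨i, j, fun hij => ?_⟩
  rw [← hij, inner_neg_right, h.inner_normal_self] at hj
  linarith

theorem aedisjoint_nearestFace (h : IsCircumscribed T n c R) :
    Pairwise (Function.onFun (AEDisjoint volume) (nearestFace T n c)) := by
  intro i j hij
  set bisector : AffineSubspace ℝ (EuclideanSpace ℝ (Fin D)) :=
    AffineSubspace.mk' c (ℝ ∙ (n i - n j))ᗮ
  have mem_bisector (x) : x ∈ bisector ↔ inner ℝ (n i - n j) (x - c) = 0 := by
    rw [AffineSubspace.mem_mk', Submodule.mem_orthogonal_singleton_iff_inner_right, vsub_eq_sub]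
  have bisector_ne_top : bisector ≠ ⊤ := by
    intro htop
    have hmem : n i - n j + c ∈ bisector := by rw [htop]; trivial
    rw [mem_bisector, add_sub_cancel_right, inner_self_eq_zero, sub_eq_zero] at hmem
    exact hij (h.injective hmem)
  refine measure_mono_null ?_ (Measure.addHaar_affineSubspace volume bisector bisector_ne_top)
  rintro x ⟨hi, hj⟩
  rw [SetLike.mem_coe, mem_bisector, inner_sub_left]
  linarith [hi.2 j, hj.2 i]

theorem exists_isTorsionFunction [Nonempty ι] (h : IsCircumscribed T n c R) {p : ℝ}
    (hp : 1 < p) : ∃ u, IsTorsionFunction p T u := by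
  obtain ⟨M, hM⟩ := h.isBounded.exists_norm_le
  obtain ⟨i⟩ := ‹Nonempty ι›
  have hM0 : 0 ≤ M := (norm_nonneg _).trans (hM c h.center_mem)
  exact (isPoincareConstant_of_abs_inner_le hp (h.norm_eq i) hM0 fun x hx =>
    (h.abs_inner_normal_le i x).trans (hM x hx)).exists_isTorsionFunction hp h.volume_ne_top

theorem inner_chart_sub_center (h : IsCircumscribed T n c R) {i : ι}
    {e : (ℝ ∙ (-n i))ᗮ × ℝ → EuclideanSpace ℝ (Fin D)}
    (he : ∀ z, e z = c + R • n i + z.1 + z.2 • -n i) (z : (ℝ ∙ (-n i))ᗮ × ℝ) :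
    inner ℝ (n i) (e z - c) = R - z.2 := by
  have hz : inner ℝ (n i) (z.1 : EuclideanSpace ℝ (Fin D)) = (0 : ℝ) := by
    simpa using Submodule.mem_orthogonal_singleton_iff_inner_right.1 z.1.2
  simp only [he, inner_sub_right, inner_add_right, inner_smul_right, inner_neg_right,
    h.inner_normal_self, hz]
  ring

variable [Finite ι]

theorem isOpen (h : IsCircumscribed T n c R) : IsOpen T := by
  have hT : T = ⋂ i, {x | inner ℝ (n i) (x - c) < R} := by
    ext x; simp [h.mem_iff]
  rw [hT]
  exact isOpen_iInter_of_finite fun i => isOpen_lt (by fun_prop) continuous_const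

theorem volume_pos (h : IsCircumscribed T n c R) : 0 < volume.real T :=
  ENNReal.toReal_pos (h.isOpen.measure_pos volume ⟨c, h.center_mem⟩).ne' h.volume_ne_top

theorem measurableSet_nearestFace (h : IsCircumscribed T n c R) (i : ι) :
    MeasurableSet (nearestFace T n c i) := by
  have hface : nearestFace T n c i =
      T ∩ ⋂ j, {x | inner ℝ (n j) (x - c) ≤ inner ℝ (n i) (x - c)} := by
    ext x; simp [nearestFace]
  rw [hface]
  exact h.isOpen.measurableSet.inter (MeasurableSet.iInter fun j =>
    (isClosed_le (by fun_prop) (by fun_prop)).measurableSet)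

/-- The height of `x` over the `i`-th face is `R - ⟪n i, x - c⟫`; lowering `x` along `n i` raises
no `⟪n j, x - c⟫` by more than `⟪n i, x - c⟫`, so the `i`-th face remains the nearest one. -/
theorem isSubgraph [Nonempty ι] (h : IsCircumscribed T n c R) {i : ι}
    {e : (ℝ ∙ (-n i))ᗮ × ℝ → EuclideanSpace ℝ (Fin D)} (hmeas : Measurable e)
    (he : ∀ z, e z = c + R • n i + z.1 + z.2 • -n i) :
    IsSubgraph (e ⁻¹' nearestFace T n c i) R := by
  refine ⟨h.pos.le, hmeas (h.measurableSet_nearestFace i), fun s t hst => ⟨?_, ?_⟩,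
    fun s t t' hst ht' htt' => ?_⟩
  · have hlt := (h.mem_iff _).1 hst.1 i
    rw [h.inner_chart_sub_center he] at hlt
    linarith
  · obtain ⟨j, hj⟩ := h.exists_inner_nonneg (e (s, t) - c)
    have hle := hst.2 j
    rw [h.inner_chart_sub_center he] at hle
    linarith
  · have inner_le (j : ι) : inner ℝ (n j) (e (s, t') - c) ≤ R - t' := by
      have hshift : e (s, t') - c = (e (s, t) - c) + (t - t') • n i := by
        rw [he, he]; module
      have hle := hst.2 j
      rw [h.inner_chart_sub_center he] at hle
      rw [hshift, inner_add_right, inner_smul_right]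
      nlinarith [h.inner_normal_le_one j i]
    refine ⟨(h.mem_iff _).2 fun j => (inner_le j).trans_lt (by linarith), fun j => ?_⟩
    rw [h.inner_chart_sub_center he]
    exact inner_le j

theorem setIntegral_nearestFace_le [Nonempty ι] (h : IsCircumscribed T n c R) (i : ι)
    {φ : EuclideanSpace ℝ (Fin D) → ℝ} (hφ : IsTestFunction T φ) {p q : ℝ}
    (hpq : p.HolderConjugate q) :
    ∫ x in nearestFace T n c i, φ x ≤
      (R ^ q * volume.real (nearestFace T n c i) / (q + 1)) ^ (1 / q) *
      (∫ x in nearestFace T n c i, |inner ℝ (∇ φ x) (-n i)| ^ p) ^ (1 / p) := by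
  obtain ⟨e, hem, he⟩ := exists_measurePreserving_orthogonal_prod
    (v := -n i) (by rw [norm_neg, h.norm_eq]) (c + R • n i)
  have hvol : volume (e ⁻¹' nearestFace T n c i) = volume (nearestFace T n c i) :=
    hem.measure_preimage (h.measurableSet_nearestFace i).nullMeasurableSet
  have hfin : volume (nearestFace T n c i) ≠ ⊤ :=
    measure_ne_top_of_subset (fun x hx => hx.1) h.volume_ne_top
  have hgrad : Continuous fun x => inner ℝ (∇ φ x) (-n i) :=
    hφ.continuous_gradient.inner continuous_const
  have hline (s : (ℝ ∙ (-n i))ᗮ) (t : ℝ) : HasDerivAt (fun t : ℝ => e (s, t)) (-n i) t := by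
    simp only [he]
    simpa using ((hasDerivAt_id t).smul_const (-n i)).const_add (c + R • n i + s)
  have hderiv (s : (ℝ ∙ (-n i))ᗮ) (t : ℝ) :
      HasDerivAt (fun t : ℝ => φ (e (s, t))) (inner ℝ (∇ φ (e (s, t))) (-n i)) t := by
    rw [inner_gradient_left]
    exact (hφ.differentiable (e (s, t))).hasFDerivAt.comp_hasDerivAt t (hline s t)
  have hzero (s : (ℝ ∙ (-n i))ᗮ) : φ (e (s, 0)) = 0 := hφ.eq_zero_of_notMem fun hmem => by
    have hlt := (h.mem_iff _).1 hmem i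
    rw [h.inner_chart_sub_center he] at hlt
    simp at hlt
  obtain ⟨C, hC⟩ := hφ.compact.exists_bound_of_continuous hφ.continuous
  obtain ⟨C', hC'⟩ :=
    hφ.hasCompactSupport_gradient.exists_bound_of_continuous hφ.continuous_gradient
  have hchart := (h.isSubgraph e.measurable he).setIntegral_le (by rwa [← hvol] at hfin)
    (f := fun z => φ (e z)) (f' := fun z => inner ℝ (∇ φ (e z)) (-n i))
    (hφ.continuous.measurable.comp e.measurable) (hgrad.measurable.comp e.measurable)
    (fun s => hgrad.comp (continuous_iff_continuousAt.2 fun t => (hline s t).continuousAt))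
    hderiv hzero (fun z => hC (e z))
    (fun z => (h.abs_inner_neg_normal_le i _).trans (hC' (e z))) hpq
  rwa [← Measure.volume_eq_prod, hem.setIntegral_preimage_emb e.measurableEmbedding φ,
    hem.setIntegral_preimage_emb e.measurableEmbedding fun x => |inner ℝ (∇ φ x) (-n i)| ^ p,
    Measure.real, hvol] at hchart

theorem setIntegral_eq_sum [Nonempty ι] [Fintype ι] (h : IsCircumscribed T n c R)
    {f : EuclideanSpace ℝ (Fin D) → ℝ} (hf : IntegrableOn f T) :
    ∫ x in T, f x = ∑ i, ∫ x in nearestFace T n c i, f x := by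
  rw [← iUnion_nearestFace T n c] at hf
  rw [← tsum_fintype (L := .unconditional _), ← integral_iUnion_ae
    (fun i => (h.measurableSet_nearestFace i).nullMeasurableSet) h.aedisjoint_nearestFace hf,
    iUnion_nearestFace]

/-- The Hersch–Makai inequality, from Hölder's inequality for sums applied to the bounds on the
single faces. -/
theorem setIntegral_le_of_isTestFunction [Nonempty ι] (h : IsCircumscribed T n c R)
    {φ : EuclideanSpace ℝ (Fin D) → ℝ} (hφ : IsTestFunction T φ) {p q : ℝ}
    (hpq : p.HolderConjugate q) :
    ∫ x in T, φ x ≤ (R ^ q * volume.real T / (q + 1)) ^ (1 / q) *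
      (∫ x in T, ‖∇ φ x‖ ^ p) ^ (1 / p) := by
  have := Fintype.ofFinite ι
  have hp := hpq.pos
  have hq := hpq.symm.pos
  have hR := h.pos
  have hgrad : IntegrableOn (fun x => ‖∇ φ x‖ ^ p) T :=
    integrable_norm_rpow hp (hφ.memLp_gradient (ENNReal.ofReal p))
  have volume_eq_sum : volume.real T = ∑ i, volume.real (nearestFace T n c i) := by
    simpa using h.setIntegral_eq_sum (integrableOn_const (C := (1 : ℝ)) h.volume_ne_top)
  have face_le (i : ι) : ∫ x in nearestFace T n c i, φ x ≤
      (R ^ q * volume.real (nearestFace T n c i) / (q + 1)) ^ (1 / q) *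
      (∫ x in nearestFace T n c i, ‖∇ φ x‖ ^ p) ^ (1 / p) := by
    have hmono : ∫ x in nearestFace T n c i, |inner ℝ (∇ φ x) (-n i)| ^ p ≤
        ∫ x in nearestFace T n c i, ‖∇ φ x‖ ^ p :=
      integral_mono_of_nonneg (.of_forall fun x => by positivity) (hgrad.mono_set fun x hx => hx.1)
        (.of_forall fun x => Real.rpow_le_rpow (abs_nonneg _) (h.abs_inner_neg_normal_le i _) hp.le)
    refine (h.setIntegral_nearestFace_le i hφ hpq).trans ?_
    gcongr
  rw [h.setIntegral_eq_sum hφ.integrable, h.setIntegral_eq_sum hgrad, volume_eq_sum,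
    Finset.mul_sum, Finset.sum_div]
  exact (Finset.sum_le_sum fun i _ => face_le i).trans (sum_rpow_mul_rpow_le hpq.symm
    (fun i => by positivity) fun i => integral_norm_rpow_nonneg _)

theorem setIntegral_le_of_isTorsionFunction [Nonempty ι] (h : IsCircumscribed T n c R) {p q : ℝ}
    (hpq : p.HolderConjugate q) {u : EuclideanSpace ℝ (Fin D) → ℝ} (hu : IsTorsionFunction p T u) :
    ∫ x in T, u x ≤ R ^ q * volume.real T / (q + 1) := by
  have := isFiniteMeasure_restrict.2 h.volume_ne_top
  have := h.pos
  have := hpq.symm.pos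
  refine hu.integral_le hpq.lt (by positivity) fun φ hφ => ?_
  have hexp : 1 - 1 / p = 1 / q := by simpa using hpq.one_sub_inv
  rw [hexp]
  exact h.setIntegral_le_of_isTestFunction hφ hpq

end IsCircumscribed

end Circumscribed

section SmoothPosPart

/-- A smooth `1`-Lipschitz approximation of the positive part that vanishes on `(-∞, δ]`. -/
def smoothPosPart (δ t : ℝ) : ℝ := ∫ s in (0)..t, Real.smoothTransition (s / δ - 1)

theorem hasDerivAt_smoothPosPart (δ t : ℝ) :
    HasDerivAt (smoothPosPart δ) (Real.smoothTransition (t / δ - 1)) t :=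
  (Continuous.integral_hasStrictDerivAt (by fun_prop) 0 t).hasDerivAt

theorem contDiff_smoothPosPart (δ : ℝ) : ContDiff ℝ ∞ (smoothPosPart δ) := by
  refine contDiff_infty_iff_deriv.2
    ⟨fun t => (hasDerivAt_smoothPosPart δ t).differentiableAt, ?_⟩
  rw [funext fun t => (hasDerivAt_smoothPosPart δ t).deriv]
  exact Real.smoothTransition.contDiff.comp (by fun_prop)

theorem smoothPosPart_eq_zero {δ t : ℝ} (hδ : 0 < δ) (ht : t ≤ δ) : smoothPosPart δ t = 0 := by
  refine intervalIntegral.integral_zero_ae (.of_forall fun s hs => ?_)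
  refine Real.smoothTransition.zero_of_nonpos (sub_nonpos.2 ((div_le_one hδ).2 ?_))
  exact (uIoc_subset_uIcc hs).2.trans (max_le hδ.le ht)

theorem monotone_smoothPosPart (δ : ℝ) : Monotone (smoothPosPart δ) :=
  monotone_of_hasDerivAt_nonneg (hasDerivAt_smoothPosPart δ) fun _ =>
    Real.smoothTransition.nonneg _

theorem smoothPosPart_nonneg {δ : ℝ} (hδ : 0 < δ) (t : ℝ) : 0 ≤ smoothPosPart δ t := by
  rw [← smoothPosPart_eq_zero hδ (min_le_right t δ)]
  exact monotone_smoothPosPart δ (min_le_left t δ)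

theorem sub_two_mul_le_smoothPosPart {δ : ℝ} (hδ : 0 < δ) (t : ℝ) :
    t - 2 * δ ≤ smoothPosPart δ t := by
  rcases le_total t (2 * δ) with ht | ht
  · linarith [smoothPosPart_nonneg hδ t]
  · have hint (a b : ℝ) :
        IntervalIntegrable (fun s => Real.smoothTransition (s / δ - 1)) volume a b :=
      Continuous.intervalIntegrable (by fun_prop) a b
    have hone : ∫ s in (2 * δ)..t, Real.smoothTransition (s / δ - 1) = ∫ s in (2 * δ)..t, 1 :=
      intervalIntegral.integral_congr fun s hs => Real.smoothTransition.one_of_one_le <| by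
        rw [uIcc_of_le ht] at hs
        rw [le_sub_iff_add_le, le_div_iff₀ hδ]
        linarith [hs.1]
    calc t - 2 * δ = ∫ s in (2 * δ)..t, Real.smoothTransition (s / δ - 1) := by simp [hone]
      _ ≤ smoothPosPart δ (2 * δ) + ∫ s in (2 * δ)..t, Real.smoothTransition (s / δ - 1) :=
        le_add_of_nonneg_left (smoothPosPart_nonneg hδ _)
      _ = smoothPosPart δ t :=
        intervalIntegral.integral_add_adjacent_intervals (hint _ _) (hint _ _)

end SmoothPosPart

section SmoothMax

variable {ι : Type*} [Fintype ι] {k : ℝ}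

/-- The log-sum-exp function, a smooth approximation of the maximum from above whose accuracy
improves as `k` grows. -/
def smoothMax (k : ℝ) (a : ι → ℝ) : ℝ := Real.log (∑ i, Real.exp (k * a i)) / k

theorem lt_smoothMax [Nontrivial ι] (hk : 0 < k) (a : ι → ℝ) (i : ι) : a i < smoothMax k a := by
  obtain ⟨j, hj⟩ := exists_ne i
  rw [smoothMax, lt_div_iff₀ hk, Real.lt_log_iff_exp_lt (by positivity), mul_comm]
  exact Finset.single_lt_sum (f := fun i => Real.exp (k * a i)) hj (Finset.mem_univ i)
    (Finset.mem_univ j) (Real.exp_pos _) fun _ _ _ => (Real.exp_pos _).le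

theorem smoothMax_le [Nonempty ι] (hk : 0 < k) {a : ι → ℝ} {m : ℝ} (h : ∀ i, a i ≤ m) :
    smoothMax k a ≤ m + Real.log (Fintype.card ι) / k := by
  rw [smoothMax, div_le_iff₀ hk, add_mul, div_mul_cancel₀ _ hk.ne',
    Real.log_le_iff_le_exp (by positivity), Real.exp_add, Real.exp_log (by positivity)]
  calc ∑ i, Real.exp (k * a i) ≤ ∑ _i : ι, Real.exp (k * m) := by
        gcongr with i
        exact h i
    _ = Real.exp (m * k) * Fintype.card ι := by simp [mul_comm]

variable {E : Type*} [NormedAddCommGroup E] [NormedSpace ℝ E] [Nonempty ι] {f : ι → E → ℝ}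

theorem contDiff_smoothMax {m : WithTop ℕ∞} (hf : ∀ i, ContDiff ℝ m (f i)) :
    ContDiff ℝ m fun x => smoothMax k fun i => f i x :=
  ((ContDiff.sum fun i _ => (contDiff_const.mul (hf i)).exp).log
    fun x => by positivity).div_const k

/-- The derivative of `smoothMax` is a convex combination of the derivatives. -/
theorem norm_fderiv_smoothMax_le (hk : 0 < k) {f' : ι → E →L[ℝ] ℝ} {x : E}
    (hf : ∀ i, HasFDerivAt (f i) (f' i) x) {C : ℝ} (hC : ∀ i, ‖f' i‖ ≤ C) :
    ‖fderiv ℝ (fun x => smoothMax k fun i => f i x) x‖ ≤ C := by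
  set S := ∑ i, Real.exp (k * f i x)
  have hS : 0 < S := by positivity
  have hderiv : HasFDerivAt (fun x => smoothMax k fun i => f i x)
      (k⁻¹ • S⁻¹ • ∑ i, Real.exp (k * f i x) • k • f' i) x := by
    simp only [smoothMax, div_eq_mul_inv]
    exact ((HasFDerivAt.fun_sum fun i _ => ((hf i).const_mul k).exp).log hS.ne').mul_const k⁻¹
  have hsum : ‖∑ i, Real.exp (k * f i x) • k • f' i‖ ≤ S * (k * C) := by
    rw [Finset.sum_mul]
    refine norm_sum_le_of_le _ fun i _ => ?_
    rw [norm_smul, norm_smul, Real.norm_of_nonneg hk.le, Real.norm_of_nonneg (Real.exp_pos _).le]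
    gcongr
    exact hC i
  rw [hderiv.fderiv, norm_smul, norm_smul, Real.norm_of_nonneg (by positivity),
    Real.norm_of_nonneg (by positivity)]
  calc k⁻¹ * (S⁻¹ * ‖∑ i, Real.exp (k * f i x) • k • f' i‖) ≤ k⁻¹ * (S⁻¹ * (S * (k * C))) := by
        gcongr
    _ = C := by field_simp

end SmoothMax

section LayerCake

variable {α : Type*} [MeasurableSpace α] {μ : Measure α} [IsFiniteMeasure μ]

theorem integral_rpow_of_measureReal_lt {g : α → ℝ} (hg : Measurable g) (hg0 : ∀ x, 0 ≤ g x)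
    (hg1 : ∀ᵐ x ∂μ, g x ≤ 1) {d : ℝ} (hd : 0 ≤ d)
    (hlt : ∀ s ∈ Ioc (0 : ℝ) 1, μ.real {x | g x < s} = s ^ d * μ.real univ) {q : ℝ} (hq : 0 < q) :
    ∫ x, g x ^ q ∂μ = μ.real univ * (d / (q + d)) := by
  have hmeas : Measurable fun x => g x ^ q := hg.pow_const q
  have hle : ∀ᵐ x ∂μ, g x ^ q ≤ 1 := hg1.mono fun x hx => Real.rpow_le_one (hg0 x) hx hq.le
  have hint : Integrable (fun x => g x ^ q) μ := .of_bound hmeas.aestronglyMeasurable 1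
    (hle.mono fun x hx => by rwa [Real.norm_of_nonneg (Real.rpow_nonneg (hg0 x) q)])
  have hsuperlevel (t : ℝ) (ht : t ∈ Ioc (0 : ℝ) 1) :
      μ.real {x | t ≤ g x ^ q} = μ.real univ * (1 - t ^ (d / q)) := by
    have hset : {x | t ≤ g x ^ q} = {x | g x < t ^ q⁻¹}ᶜ := by
      ext x
      simp only [mem_ofPred_eq, mem_compl_iff, not_lt]
      rw [Real.rpow_inv_le_iff_of_pos ht.1.le (hg0 x) hq]
    rw [hset, measureReal_compl (measurableSet_lt hg measurable_const), hlt _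
      ⟨Real.rpow_pos_of_pos ht.1 _, Real.rpow_le_one ht.1.le ht.2 (by positivity)⟩,
      ← Real.rpow_mul ht.1.le, inv_mul_eq_div]
    ring
  have hexp : 0 < d / q + 1 := by positivity
  calc ∫ x, g x ^ q ∂μ = ∫ t in Ioc 0 1, μ.real {x | t ≤ g x ^ q} :=
        hint.integral_eq_integral_Ioc_meas_le (.of_forall fun x => Real.rpow_nonneg (hg0 x) q) hle
    _ = μ.real univ * ∫ t in (0)..1, (1 - t ^ (d / q)) := by
        rw [setIntegral_congr_fun measurableSet_Ioc hsuperlevel, integral_const_mul,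
          intervalIntegral.integral_of_le zero_le_one]
    _ = μ.real univ * (d / (q + d)) := by
        rw [intervalIntegral.integral_sub intervalIntegrable_const
          (intervalIntegral.intervalIntegrable_rpow' (by linarith)),
          integral_rpow (Or.inl (by linarith)), Real.zero_rpow hexp.ne', Real.one_rpow,
          intervalIntegral.integral_const]
        congr 1
        simp only [sub_zero, smul_eq_mul, mul_one]
        field_simp
        ring

end LayerCake

section Gauge

/-- The gauge, with respect to `c`, of the polytope cut out by the tangent hyperplanes with unit
outer normals `n i` of the ball with centre `c` and radius `R`. -/
def polytopeGauge {D : ℕ} {ι : Type*} (n : ι → EuclideanSpace ℝ (Fin D))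
    (c : EuclideanSpace ℝ (Fin D)) (R : ℝ) (x : EuclideanSpace ℝ (Fin D)) : ℝ :=
  ⨆ i, inner ℝ (n i) (x - c) / R

variable {D : ℕ} {ι : Type*} {T : Set (EuclideanSpace ℝ (Fin D))}
  {n : ι → EuclideanSpace ℝ (Fin D)} {c : EuclideanSpace ℝ (Fin D)} {R : ℝ} [Finite ι]

theorem le_polytopeGauge (x : EuclideanSpace ℝ (Fin D)) (i : ι) :
    inner ℝ (n i) (x - c) / R ≤ polytopeGauge n c R x :=
  le_ciSup (f := fun i => inner ℝ (n i) (x - c) / R) (Finite.bddAbove_range _) i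

theorem measurable_polytopeGauge : Measurable (polytopeGauge n c R) :=
  Measurable.iSup fun i => by fun_prop

variable [Nonempty ι]

theorem exists_eq_polytopeGauge (x : EuclideanSpace ℝ (Fin D)) :
    ∃ i, inner ℝ (n i) (x - c) / R = polytopeGauge n c R x :=
  exists_eq_ciSup_of_finite

theorem polytopeGauge_lt_iff {x : EuclideanSpace ℝ (Fin D)} {s : ℝ} :
    polytopeGauge n c R x < s ↔ ∀ i, inner ℝ (n i) (x - c) / R < s := by
  refine ⟨fun hx i => (le_polytopeGauge x i).trans_lt hx, fun hx => ?_⟩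
  obtain ⟨i, hi⟩ := exists_eq_polytopeGauge (n := n) (c := c) (R := R) x
  exact hi ▸ hx i

namespace IsCircumscribed

theorem polytopeGauge_nonneg (h : IsCircumscribed T n c R) (x : EuclideanSpace ℝ (Fin D)) :
    0 ≤ polytopeGauge n c R x := by
  obtain ⟨i, hi⟩ := h.exists_inner_nonneg (x - c)
  exact (div_nonneg hi h.pos.le).trans (le_polytopeGauge x i)

theorem mem_iff_polytopeGauge_lt_one (h : IsCircumscribed T n c R)
    (x : EuclideanSpace ℝ (Fin D)) : x ∈ T ↔ polytopeGauge n c R x < 1 := by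
  simp only [h.mem_iff, polytopeGauge_lt_iff, div_lt_one h.pos]

theorem setOf_polytopeGauge_lt_eq_image_homothety (h : IsCircumscribed T n c R) {s : ℝ}
    (hs : 0 < s) : {x | polytopeGauge n c R x < s} = AffineMap.homothety c s '' T := by
  ext x
  simp only [mem_ofPred_eq, mem_image, AffineMap.homothety_apply, vsub_eq_sub, vadd_eq_add,
    polytopeGauge_lt_iff, div_lt_iff₀ h.pos]
  constructor
  · intro hx
    refine ⟨c + s⁻¹ • (x - c), (h.mem_iff _).2 fun i => ?_, ?_⟩
    · rw [add_sub_cancel_left, inner_smul_right, inv_mul_lt_iff₀ hs]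
      exact hx i
    · rw [add_sub_cancel_left, smul_inv_smul₀ hs.ne', sub_add_cancel]
  · rintro ⟨y, hy, rfl⟩ i
    rw [add_sub_cancel_right, inner_smul_right]
    exact mul_lt_mul_of_pos_left ((h.mem_iff y).1 hy i) hs

theorem measureReal_polytopeGauge_lt (h : IsCircumscribed T n c R) {s : ℝ} (hs : 0 < s) :
    volume.real {x | polytopeGauge n c R x < s} = s ^ D * volume.real T := by
  rw [h.setOf_polytopeGauge_lt_eq_image_homothety hs, Measure.real,
    Measure.addHaar_image_homothety, ENNReal.toReal_mul, ENNReal.toReal_ofReal (abs_nonneg _)]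
  simp [Measure.real, abs_of_pos hs]

theorem integral_polytopeGauge_rpow (h : IsCircumscribed T n c R) {q : ℝ} (hq : 0 < q) :
    ∫ x in T, polytopeGauge n c R x ^ q = volume.real T * (D / (q + D)) := by
  have := isFiniteMeasure_restrict.2 h.volume_ne_top
  rw [integral_rpow_of_measureReal_lt measurable_polytopeGauge h.polytopeGauge_nonneg
    (ae_restrict_of_forall_mem h.isOpen.measurableSet fun x hx =>
      ((h.mem_iff_polytopeGauge_lt_one x).1 hx).le) (Nat.cast_nonneg D) (fun s hs => ?_) hq,
    measureReal_restrict_apply_univ]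
  have hsubset : {x | polytopeGauge n c R x < s} ⊆ T := fun x hx =>
    (h.mem_iff_polytopeGauge_lt_one x).2 (lt_of_lt_of_le hx hs.2)
  rw [measureReal_restrict_apply_univ, measureReal_restrict_apply (measurableSet_lt
    measurable_polytopeGauge measurable_const), inter_eq_self_of_subset_left hsubset,
    h.measureReal_polytopeGauge_lt hs.1, Real.rpow_natCast]

theorem integrableOn_polytopeGauge_add_rpow (h : IsCircumscribed T n c R) {q : ℝ} (hq : 0 < q)
    {ε : ℝ} (hε : 0 ≤ ε) : IntegrableOn (fun x => (polytopeGauge n c R x + ε) ^ q) T := by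
  refine Measure.integrableOn_of_bounded (M := (1 + ε) ^ q) h.volume_ne_top
    ((measurable_polytopeGauge.add_const ε).pow_const q).aestronglyMeasurable
    (ae_restrict_of_forall_mem h.isOpen.measurableSet fun x hx => ?_)
  have hnonneg := h.polytopeGauge_nonneg x
  have hlt := (h.mem_iff_polytopeGauge_lt_one x).1 hx
  rw [Real.norm_of_nonneg (by positivity)]
  gcongr

theorem tendsto_integral_polytopeGauge_add_rpow (h : IsCircumscribed T n c R) {q : ℝ}
    (hq : 0 < q) : Tendsto (fun ε => ∫ x in T, (polytopeGauge n c R x + ε) ^ q) (𝓝[>] 0)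
      (𝓝 (volume.real T * (D / (q + D)))) := by
  rw [← h.integral_polytopeGauge_rpow hq]
  refine tendsto_integral_filter_of_dominated_convergence
    (fun x => (polytopeGauge n c R x + 1) ^ q)
    (.of_forall fun ε => ((measurable_polytopeGauge.add_const ε).pow_const q).aestronglyMeasurable)
    ?_ (h.integrableOn_polytopeGauge_add_rpow hq zero_le_one) (.of_forall fun x => ?_)
  · filter_upwards [Ioo_mem_nhdsGT one_pos] with ε hε
    refine .of_forall fun x => ?_
    have hnonneg : 0 ≤ polytopeGauge n c R x + ε := add_nonneg (h.polytopeGauge_nonneg x) hε.1.le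
    rw [Real.norm_of_nonneg (by positivity)]
    gcongr
    exact hε.2.le
  · have hcont : Continuous fun ε : ℝ => (polytopeGauge n c R x + ε) ^ q :=
      (continuous_const.add continuous_id).rpow_const fun _ => Or.inr hq.le
    exact (hcont.tendsto' 0 _ (by simp)).mono_left nhdsWithin_le_nhds

theorem exists_contDiff_gauge (h : IsCircumscribed T n c R) {ε : ℝ} (hε : 0 < ε) :
    ∃ M : EuclideanSpace ℝ (Fin D) → ℝ, ContDiff ℝ ∞ M ∧ (∀ x, polytopeGauge n c R x < M x) ∧
      (∀ x, M x ≤ polytopeGauge n c R x + ε) ∧ ∀ x, ‖fderiv ℝ M x‖ ≤ 1 / R := by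
  have := Fintype.ofFinite ι
  have := h.nontrivial
  have hR := h.pos
  set L := Real.log (Fintype.card ι)
  have hL : 0 < L := Real.log_pos (mod_cast Fintype.one_lt_card)
  have hk : 0 < L / ε := div_pos hL hε
  have hderiv (i : ι) (x : EuclideanSpace ℝ (Fin D)) :
      HasFDerivAt (fun x => inner ℝ (n i) (x - c) / R) (R⁻¹ • innerSL ℝ (n i)) x := by
    simp only [div_eq_mul_inv]
    exact ((innerSL ℝ (n i)).hasFDerivAt.comp x ((hasFDerivAt_id x).sub_const c)).mul_const R⁻¹
  refine ⟨fun x => smoothMax (L / ε) fun i => inner ℝ (n i) (x - c) / R,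
    contDiff_smoothMax fun i =>
      (contDiff_const.inner ℝ (contDiff_id.sub contDiff_const)).div_const R,
    fun x => ?_, fun x => ?_, fun x => ?_⟩
  · obtain ⟨i, hi⟩ := exists_eq_polytopeGauge (n := n) (c := c) (R := R) x
    exact hi ▸ lt_smoothMax hk (fun i => inner ℝ (n i) (x - c) / R) i
  · refine (smoothMax_le hk fun i => le_polytopeGauge x i).trans_eq ?_
    rw [div_div_cancel₀ hL.ne']
  · refine norm_fderiv_smoothMax_le hk (fun i => hderiv i x) fun i => ?_
    rw [norm_smul, innerSL_apply_norm, h.norm_eq, mul_one, Real.norm_of_nonneg (by positivity),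
      one_div]

end IsCircumscribed

end Gauge

section LowerBound

theorem norm_gradient_smoothPosPart_one_sub_rpow_le {E : Type*} [NormedAddCommGroup E]
    [InnerProductSpace ℝ E] [CompleteSpace E] {M : E → ℝ} {x : E} (hM : DifferentiableAt ℝ M x)
    (hpos : 0 < M x) {C : ℝ} (hC : ‖fderiv ℝ M x‖ ≤ C) (δ : ℝ) {q : ℝ} (hq : 0 ≤ q) :
    ‖∇ (fun y => smoothPosPart δ (1 - M y ^ q)) x‖ ≤ q * C * M x ^ (q - 1) := by
  have hbump : HasFDerivAt (fun y => 1 - M y ^ q) (-((q * M x ^ (q - 1)) • fderiv ℝ M x)) x :=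
    (hM.hasFDerivAt.rpow_const (Or.inl hpos.ne')).const_sub 1
  have hderiv := ((hasDerivAt_smoothPosPart δ (1 - M x ^ q)).comp_hasFDerivAt x hbump).fderiv
  rw [Function.comp_def] at hderiv
  rw [gradient, LinearIsometryEquiv.norm_map, hderiv, norm_smul, norm_neg,
    norm_smul, Real.norm_of_nonneg (Real.smoothTransition.nonneg _),
    Real.norm_of_nonneg (by positivity)]
  calc _ ≤ 1 * (q * M x ^ (q - 1) * C) := by
        gcongr
        exact Real.smoothTransition.le_one _
    _ = q * C * M x ^ (q - 1) := by ring

variable {D : ℕ} {ι : Type*} {T : Set (EuclideanSpace ℝ (Fin D))}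
  {n : ι → EuclideanSpace ℝ (Fin D)} {c : EuclideanSpace ℝ (Fin D)} {R : ℝ} [Finite ι] [Nonempty ι]

namespace IsCircumscribed

theorem exists_testFunction (h : IsCircumscribed T n c R) {p q : ℝ}
    (hpq : p.HolderConjugate q) {ε : ℝ} (hε : 0 < ε) :
    ∃ φ, IsTestFunction T φ ∧ (∀ x, 1 - (polytopeGauge n c R x + ε) ^ q - ε ≤ φ x) ∧
      ∀ x, ‖∇ φ x‖ ^ p ≤ (q / R) ^ p * (polytopeGauge n c R x + ε) ^ q := by
  have hq := hpq.symm.pos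
  have hR := h.pos
  have hδ := half_pos hε
  obtain ⟨M, hM, hlt, hle, hgrad⟩ := h.exists_contDiff_gauge hε
  have hpos (x) : 0 < M x := (h.polytopeGauge_nonneg x).trans_lt (hlt x)
  have hrpow (x) : M x ^ q ≤ (polytopeGauge n c R x + ε) ^ q :=
    Real.rpow_le_rpow (hpos x).le (hle x) hq.le
  have hbump : ContDiff ℝ ∞ fun x => 1 - M x ^ q :=
    contDiff_const.sub (hM.rpow_const_of_ne fun x => (hpos x).ne')
  have hsupport : tsupport (fun x => smoothPosPart (ε / 2) (1 - M x ^ q)) ⊆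
      {x | ε / 2 ≤ 1 - M x ^ q} :=
    closure_minimal (fun x hx => (lt_of_not_ge fun hle => hx (smoothPosPart_eq_zero hδ hle)).le)
      (isClosed_le continuous_const hbump.continuous)
  have tsupport_subset : tsupport (fun x => smoothPosPart (ε / 2) (1 - M x ^ q)) ⊆ T := by
    intro x hx
    have hx' : ε / 2 ≤ 1 - M x ^ q := hsupport hx
    rw [h.mem_iff_polytopeGauge_lt_one]
    refine (hlt x).trans (lt_of_not_ge fun hge => ?_)
    linarith [Real.one_le_rpow hge hq.le]
  refine ⟨fun x => smoothPosPart (ε / 2) (1 - M x ^ q),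
    ⟨(contDiff_smoothPosPart _).comp hbump, ?_, tsupport_subset⟩, fun x => ?_, fun x => ?_⟩
  · exact Metric.isCompact_of_isClosed_isBounded (isClosed_tsupport _)
      (h.isBounded.subset tsupport_subset)
  · linarith [sub_two_mul_le_smoothPosPart hδ (1 - M x ^ q), hrpow x]
  · have hnorm := norm_gradient_smoothPosPart_one_sub_rpow_le (hM.differentiable (by simp) x)
      (hpos x) (hgrad x) (ε / 2) hq.le
    have hexp : (q - 1) * p = q := by linarith [hpq.symm.sub_one_mul_conj]
    calc _ ≤ (q * (1 / R) * M x ^ (q - 1)) ^ p := by gcongr; exact hpq.nonneg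
      _ = (q / R) ^ p * M x ^ q := by
        rw [Real.mul_rpow (by positivity) (Real.rpow_nonneg (hpos x).le _),
          ← Real.rpow_mul (hpos x).le, hexp, mul_one_div]
      _ ≤ (q / R) ^ p * (polytopeGauge n c R x + ε) ^ q :=
        mul_le_mul_of_nonneg_left (hrpow x) (by positivity)

end IsCircumscribed

end LowerBound

theorem exists_torsionalRigidity_eq {D : ℕ} {Ω : Set (EuclideanSpace ℝ (Fin D))} {p : ℝ}
    (h : ∃ u, IsTorsionFunction p Ω u) :
    ∃ u, IsTorsionFunction p Ω u ∧ torsionalRigidity p Ω = ∫ x in Ω, u x :=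
  ⟨h.choose, h.choose_spec, by rw [torsionalRigidity, dif_pos h]⟩

theorem rpow_le_mul_rpow_sub_one {p q : ℝ} (hpq : p.HolderConjugate q) {a b c : ℝ} (ha : 0 ≤ a)
    (hb : 0 ≤ b) (hc : 0 ≤ c) (h : a ≤ b ^ (1 - 1 / p) * c ^ (1 / p)) :
    a ^ q ≤ b * c ^ (q - 1) := by
  have hq := hpq.symm.pos
  have hexpb : (1 - 1 / p) * q = 1 := by
    rw [one_div, hpq.one_sub_inv, inv_mul_cancel₀ hq.ne']
  have hexpc : 1 / p * q = q - 1 := by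
    rw [one_div, inv_mul_eq_div, hpq.symm.div_conj_eq_sub_one]
  calc a ^ q ≤ (b ^ (1 - 1 / p) * c ^ (1 / p)) ^ q := by gcongr
    _ = b * c ^ (q - 1) := by
      rw [Real.mul_rpow (by positivity) (by positivity), ← Real.rpow_mul hb, ← Real.rpow_mul hc,
        hexpb, hexpc, Real.rpow_one]

section Bounds

variable {D : ℕ} {ι : Type*} {T : Set (EuclideanSpace ℝ (Fin D))}
  {n : ι → EuclideanSpace ℝ (Fin D)} {c : EuclideanSpace ℝ (Fin D)} {R : ℝ}

namespace IsCircumscribed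

theorem dim_pos [Nonempty ι] (h : IsCircumscribed T n c R) : 0 < D := by
  refine Nat.pos_of_ne_zero ?_
  rintro rfl
  have hnorm := h.norm_eq (Classical.arbitrary ι)
  rw [Subsingleton.elim (n _) 0, norm_zero] at hnorm
  exact zero_ne_one hnorm

variable [Nonempty ι]

theorem inradius_eq (h : IsCircumscribed T n c R) : inradius T = R := by
  refine IsGreatest.csSup_eq ⟨⟨h.pos.le, c, fun x hx => (h.mem_iff x).2 fun i => ?_⟩, ?_⟩
  · have hle := real_inner_le_norm (n i) (x - c)
    rw [h.norm_eq, one_mul] at hle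
    exact hle.trans_lt (mem_ball_iff_norm.1 hx)
  · rintro r ⟨-, x, hball⟩
    obtain ⟨i, hi⟩ := h.exists_inner_nonneg (x - c)
    refine le_of_forall_lt fun s hs => ?_
    rcases lt_or_ge s 0 with hneg | hnonneg
    · exact hneg.trans h.pos
    have hmem : x + s • n i ∈ Metric.ball x r := by
      rwa [mem_ball_iff_norm, add_sub_cancel_left, norm_smul, h.norm_eq, mul_one,
        Real.norm_of_nonneg hnonneg]
    have hlt := (h.mem_iff _).1 (hball hmem) i
    rw [add_sub_right_comm, inner_add_right, inner_smul_right, real_inner_self_eq_norm_sq,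
      h.norm_eq] at hlt
    linarith

variable [Finite ι] {p q : ℝ}

theorem le_integral_torsion_of_pos (h : IsCircumscribed T n c R) (hpq : p.HolderConjugate q)
    {u : EuclideanSpace ℝ (Fin D) → ℝ} (hu : IsTorsionFunction p T u) {ε : ℝ} (hε : 0 < ε) :
    volume.real T - (∫ x in T, (polytopeGauge n c R x + ε) ^ q) - ε * volume.real T ≤
      (∫ x in T, u x) ^ (1 - 1 / p) *
        ((q / R) ^ p * ∫ x in T, (polytopeGauge n c R x + ε) ^ q) ^ (1 / p) := by
  have := isFiniteMeasure_restrict.2 h.volume_ne_top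
  have hp := hpq.pos
  obtain ⟨φ, hφ, hlower, hgrad⟩ := h.exists_testFunction hpq hε
  have hgauge : Integrable (fun x => (polytopeGauge n c R x + ε) ^ q) (volume.restrict T) :=
    h.integrableOn_polytopeGauge_add_rpow hpq.symm.pos hε.le
  have hbump : Integrable (fun x => 1 - (polytopeGauge n c R x + ε) ^ q) (volume.restrict T) :=
    (integrable_const 1).sub hgauge
  have hu_nonneg := hu.integral_nonneg hpq.lt
  calc _ = ∫ x in T, (1 - (polytopeGauge n c R x + ε) ^ q - ε) := by
        rw [integral_sub hbump (integrable_const ε), integral_sub (integrable_const 1) hgauge]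
        simp [mul_comm]
    _ ≤ ∫ x in T, φ x := integral_mono (hbump.sub (integrable_const ε)) hφ.integrable hlower
    _ ≤ _ := hu.integral_le_rpow_mul_rpow hpq.lt (hφ.memW10 p)
    _ ≤ _ := by
        have : 0 ≤ ∫ x in T, ‖∇ φ x‖ ^ p := integral_norm_rpow_nonneg _
        gcongr
        rw [← integral_const_mul]
        exact integral_mono (integrable_norm_rpow hp (hφ.memLp_gradient _))
          (hgauge.const_mul _) hgrad

theorem le_integral_torsion_rpow (h : IsCircumscribed T n c R) (hpq : p.HolderConjugate q)
    {u : EuclideanSpace ℝ (Fin D) → ℝ} (hu : IsTorsionFunction p T u) :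
    volume.real T * (q / (q + D)) ≤ (∫ x in T, u x) ^ (1 - 1 / p) *
      ((q / R) ^ p * (volume.real T * (D / (q + D)))) ^ (1 / p) := by
  have hq := hpq.symm.pos
  have hlim := h.tendsto_integral_polytopeGauge_add_rpow hq
  have hε : Tendsto (fun ε : ℝ => ε * volume.real T) (𝓝[>] 0) (𝓝 0) :=
    ((continuous_mul_const _).tendsto' 0 0 (zero_mul _)).mono_left nhdsWithin_le_nhds
  have hlhs := (hlim.const_sub (volume.real T)).sub hε
  have hrhs := ((hlim.const_mul ((q / R) ^ p)).rpow_const (p := 1 / p)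
    (Or.inr (one_div_nonneg.2 hpq.nonneg))).const_mul ((∫ x in T, u x) ^ (1 - 1 / p))
  refine (le_of_eq ?_).trans (le_of_tendsto_of_tendsto hlhs hrhs ?_)
  · field_simp
    ring
  · filter_upwards [self_mem_nhdsWithin] with ε hε using h.le_integral_torsion_of_pos hpq hu hε

theorem torsionalRigidity_le (h : IsCircumscribed T n c R) (hpq : p.HolderConjugate q) :
    torsionalRigidity p T ≤ R ^ q * volume.real T / (q + 1) := by
  obtain ⟨u, hu, heq⟩ := exists_torsionalRigidity_eq (h.exists_isTorsionFunction hpq.lt)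
  exact heq ▸ h.setIntegral_le_of_isTorsionFunction hpq hu

theorem le_torsionalRigidity (h : IsCircumscribed T n c R) (hpq : p.HolderConjugate q) :
    R ^ q * volume.real T / ((q + D) * (D : ℝ) ^ (q - 1)) ≤ torsionalRigidity p T := by
  obtain ⟨u, hu, heq⟩ := exists_torsionalRigidity_eq (h.exists_isTorsionFunction hpq.lt)
  have := isFiniteMeasure_restrict.2 h.volume_ne_top
  have hI := hu.integral_nonneg hpq.lt
  have hle := h.le_integral_torsion_rpow hpq hu
  rw [← heq] at hI hle
  have hq := hpq.symm.pos
  have hR := h.pos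
  have hV := h.volume_pos
  have hD : (0 : ℝ) < D := mod_cast h.dim_pos
  set I := torsionalRigidity p T
  set B := volume.real T * (D / (q + D)) with hBdef
  have hB : 0 < B := by positivity
  have henergy : ((q / R) ^ p * B) ^ (q - 1) = (q / R) ^ q * B ^ (q - 1) := by
    have hexp : p * (q - 1) = q := by linarith [hpq.symm.sub_one_mul_conj]
    rw [Real.mul_rpow (by positivity) hB.le, ← Real.rpow_mul (by positivity), hexp]
  have hpow : B * (q / D) ^ q ≤ I * (q / R) ^ q := by
    refine le_of_mul_le_mul_right ?_ (Real.rpow_pos_of_pos hB (q - 1))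
    calc B * (q / D) ^ q * B ^ (q - 1) = (volume.real T * (q / (q + D))) ^ q := by
          rw [mul_right_comm, mul_comm B, ← Real.rpow_add_one hB.ne', sub_add_cancel,
            ← Real.mul_rpow hB.le (by positivity), hBdef]
          field_simp
      _ ≤ I * ((q / R) ^ p * B) ^ (q - 1) :=
        rpow_le_mul_rpow_sub_one hpq (by positivity) hI (by positivity) hle
      _ = I * (q / R) ^ q * B ^ (q - 1) := by rw [henergy, mul_assoc]
  rw [Real.div_rpow hq.le hD.le, Real.div_rpow hq.le hR.le] at hpow
  calc R ^ q * volume.real T / ((q + D) * (D : ℝ) ^ (q - 1))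
      = B * (q ^ q / (D : ℝ) ^ q) / (q ^ q / R ^ q) := by
        rw [hBdef, Real.rpow_sub_one hD.ne']
        field_simp
    _ ≤ I := by
        rw [div_le_iff₀ (by positivity)]
        exact hpow

theorem torsionalRigidity_pos (h : IsCircumscribed T n c R) (hpq : p.HolderConjugate q) :
    0 < torsionalRigidity p T := by
  refine lt_of_lt_of_le ?_ (h.le_torsionalRigidity hpq)
  have hq := hpq.symm.pos
  have hR := h.pos
  have hV := h.volume_pos
  have hD : (0 : ℝ) < D := mod_cast h.dim_pos
  positivity

theorem Q_eq_rpow (h : IsCircumscribed T n c R) (hpq : p.HolderConjugate q) :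
    Q p T = (R ^ q * volume.real T / ((q + 1) * torsionalRigidity p T)) ^ (1 / q) := by
  have hq := hpq.symm.pos
  have hI := h.torsionalRigidity_pos hpq
  have hV := h.volume_pos
  have hR := h.pos
  have hconst : (2 * p - 1) / (p - 1) = q + 1 := by
    have hp := hpq.sub_one_pos.ne'
    rw [hpq.conjugate_eq]
    field_simp
    ring
  have hexpR : q * (p - 1) = p := by rw [mul_comm, hpq.sub_one_mul_conj]
  have hexp : (p - 1) * (1 / p) = 1 / q := by
    rw [mul_one_div, one_div, ← hpq.one_sub_inv, sub_div, div_self hpq.ne_zero, one_div]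
  have hbase : volume.real T ^ (p - 1) * torsionalRigidity p T ^ (1 - p) * R ^ p /
      (q + 1) ^ (p - 1) =
        (R ^ q * volume.real T / ((q + 1) * torsionalRigidity p T)) ^ (p - 1) := by
    rw [Real.div_rpow (by positivity) (by positivity), Real.mul_rpow (by positivity) hV.le,
      Real.mul_rpow (by positivity) hI.le, ← Real.rpow_mul hR.le, hexpR, ← neg_sub p 1,
      Real.rpow_neg hI.le]
    field_simp
  rw [Q, normalizedRigidity, h.inradius_eq, hconst, hbase, ← Real.rpow_mul (by positivity), hexp]

theorem one_le_Q (h : IsCircumscribed T n c R) (hpq : p.HolderConjugate q) : 1 ≤ Q p T := by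
  have hq := hpq.symm.pos
  have hI := h.torsionalRigidity_pos hpq
  have hle := h.torsionalRigidity_le hpq
  rw [h.Q_eq_rpow hpq]
  refine Real.one_le_rpow ?_ (by positivity)
  rwa [one_le_div (by positivity), ← le_div_iff₀' (by positivity)]

theorem Q_lt_dim (h : IsCircumscribed T n c R) (hpq : p.HolderConjugate q) (hD : 1 < D) :
    Q p T < D := by
  have hq := hpq.symm.pos
  have hI := h.torsionalRigidity_pos hpq
  have hle := h.le_torsionalRigidity hpq
  have hD' : (1 : ℝ) < D := mod_cast hD
  rw [div_le_iff₀ (by positivity)] at hle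
  have hlt : R ^ q * volume.real T / ((q + 1) * torsionalRigidity p T) < (D : ℝ) ^ q := by
    rw [div_lt_iff₀ (by positivity)]
    calc _ ≤ torsionalRigidity p T * ((q + D) * (D : ℝ) ^ (q - 1)) := hle
      _ < torsionalRigidity p T * (D * (q + 1) * (D : ℝ) ^ (q - 1)) := by
        gcongr
        nlinarith
      _ = (D : ℝ) ^ q * ((q + 1) * torsionalRigidity p T) := by
        rw [Real.rpow_sub_one (by positivity)]
        field_simp
  have hR := h.pos
  rw [h.Q_eq_rpow hpq, one_div]
  exact (Real.rpow_inv_lt_iff_of_pos (by positivity) (by positivity) hq).2 hlt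

end IsCircumscribed

end Bounds

section Facets

variable {ι E : Type*} [NormedAddCommGroup E] [NormedSpace ℝ E] (B : AffineBasis ι ℝ E)

/-- The facet of a simplex opposite to the `i`-th vertex. -/
def facet (i : ι) : Set E := {x | (∀ j, 0 ≤ B.coord j x) ∧ B.coord i x = 0}

theorem frontier_interior_convexHull [Finite ι] :
    frontier (interior (convexHull ℝ (range B))) = ⋃ i, facet B i := by
  have := Fintype.ofFinite ι
  have hclosed : IsClosed (convexHull ℝ (range B)) := (finite_range B).isClosed_convexHull ℝ
  rw [frontier, interior_interior,
    (convex_convexHull ℝ _).closure_interior_eq_closure_of_nonempty_interior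
      ⟨_, B.centroid_mem_interior_convexHull⟩,
    hclosed.closure_eq, B.interior_convexHull, B.convexHull_eq_nonneg_coord]
  ext x
  simp only [Set.mem_sdiff, mem_ofPred_eq, not_forall, not_lt, mem_iUnion, facet]
  exact ⟨fun ⟨hnonneg, i, hi⟩ => ⟨i, hnonneg, hi.antisymm (hnonneg i)⟩,
    fun ⟨i, hnonneg, hi⟩ => ⟨hnonneg, i, hi.le⟩⟩

theorem isClosed_facet [FiniteDimensional ℝ E] (i : ι) : IsClosed (facet B i) := by
  have hcont := continuous_barycentric_coord B
  simp only [facet, ofPred_and, ofPred_forall]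
  exact (isClosed_iInter fun j => isClosed_le continuous_const (hcont j)).inter
    (isClosed_eq (hcont i) continuous_const)

end Facets

section Simplex

theorem coord_sum_smul {k V ι : Type*} [Ring k] [AddCommGroup V] [Module k V] [Fintype ι]
    (B : AffineBasis ι k V) {w : ι → k} (hw : ∑ i, w i = 1) (i : ι) :
    B.coord i (∑ j, w j • B j) = w i := by
  rw [← Finset.univ.affineCombination_eq_linear_combination B w hw,
    B.coord_apply_combination_of_mem (Finset.mem_univ i) hw]

variable {ι E : Type*} [NormedAddCommGroup E] [InnerProductSpace ℝ E] [FiniteDimensional ℝ E]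
  (B : AffineBasis ι ℝ E)

/-- The gradient of the `i`-th barycentric coordinate. Its norm is the inverse of the altitude
from the `i`-th vertex. -/
def coordGradient (i : ι) : E :=
  (InnerProductSpace.toDual ℝ E).symm (B.coord i).linear.toContinuousLinearMap

theorem inner_coordGradient (i : ι) (x y : E) :
    inner ℝ (coordGradient B i) (x - y) = B.coord i x - B.coord i y := by
  rw [coordGradient, InnerProductSpace.toDual_symm_apply]
  exact (B.coord i).linearMap_vsub x y

theorem inner_coordGradient_vertex_sub {i j : ι} (hij : i ≠ j) :
    inner ℝ (coordGradient B i) (B i - B j) = 1 := by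
  rw [inner_coordGradient, B.coord_apply_eq, B.coord_apply_ne hij, sub_zero]

theorem norm_coordGradient_pos [Nontrivial ι] (i : ι) : 0 < ‖coordGradient B i‖ := by
  obtain ⟨j, hji⟩ := exists_ne i
  refine norm_pos_iff.2 fun hzero => ?_
  have hone := inner_coordGradient_vertex_sub B hji.symm
  rw [hzero, inner_zero_left] at hone
  exact zero_ne_one hone

theorem normalize_coordGradient_injective [Nontrivial ι] :
    Function.Injective fun i => -(‖coordGradient B i‖⁻¹ • coordGradient B i) := by
  intro i j hij
  by_contra hne
  have hi := norm_coordGradient_pos B i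
  have hj := norm_coordGradient_pos B j
  have heq := congrArg (inner ℝ · (B i - B j)) (neg_inj.1 hij)
  rw [← neg_sub (B j)] at heq
  simp only [real_inner_smul_left] at heq
  rw [inner_neg_right, inner_neg_right, inner_coordGradient_vertex_sub B (Ne.symm hne), ← neg_sub,
    inner_neg_right, inner_coordGradient_vertex_sub B hne] at heq
  have : 0 < ‖coordGradient B i‖⁻¹ + ‖coordGradient B j‖⁻¹ := by positivity
  linarith

variable [Nontrivial ι] [Fintype ι]

/-- The incentre is the point whose barycentric coordinates are proportional to the inverse
altitudes. -/
def incenter : E := ∑ i, (‖coordGradient B i‖ / ∑ j, ‖coordGradient B j‖) • B i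

theorem isCircumscribed_interior_convexHull {D : ℕ}
    (B : AffineBasis ι ℝ (EuclideanSpace ℝ (Fin D))) :
    IsCircumscribed (interior (convexHull ℝ (range B)))
      (fun i => -(‖coordGradient B i‖⁻¹ • coordGradient B i)) (incenter B)
      (∑ i, ‖coordGradient B i‖)⁻¹ := by
  have hpos := norm_coordGradient_pos B
  have hsum : 0 < ∑ i, ‖coordGradient B i‖ :=
    Finset.sum_pos (fun i _ => hpos i) Finset.univ_nonempty
  refine ⟨inv_pos.2 hsum, fun i => ?_, normalize_coordGradient_injective B, fun x => ?_,
    (isBounded_convexHull.2 (finite_range B).isBounded).subset interior_subset⟩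
  · rw [norm_neg, norm_smul, norm_inv, norm_norm, inv_mul_cancel₀ (hpos i).ne']
  · rw [B.interior_convexHull, mem_ofPred_eq]
    refine forall_congr' fun i => ?_
    have hweights : ∑ i, ‖coordGradient B i‖ / ∑ j, ‖coordGradient B j‖ = 1 := by
      rw [← Finset.sum_div, div_self hsum.ne']
    have hinner : inner ℝ (-(‖coordGradient B i‖⁻¹ • coordGradient B i)) (x - incenter B) =
        (∑ i, ‖coordGradient B i‖)⁻¹ - ‖coordGradient B i‖⁻¹ * B.coord i x := by
      have hne := (hpos i).ne'
      rw [inner_neg_left, real_inner_smul_left, inner_coordGradient, incenter,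
        coord_sum_smul B hweights]
      field_simp
      ring
    rw [hinner, sub_lt_self_iff, mul_pos_iff_of_pos_left (inv_pos.2 (hpos i))]

end Simplex

section Triangle

/-- The standard orientation of the plane. -/
def planeOrientation : Orientation ℝ (EuclideanSpace ℝ (Fin 2)) (Fin 2) :=
  (EuclideanSpace.basisFun (Fin 2) ℝ).toBasis.orientation

instance fact_finrank_euclideanSpace_fin_two :
    Fact (Module.finrank ℝ (EuclideanSpace ℝ (Fin 2)) = 2) := ⟨by simp⟩

theorem sum_fin_three_eq_add_add {M : Type*} [AddCommMonoid M] (f : Fin 3 → M) (i : Fin 3) :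
    ∑ j, f j = f i + f (i + 1) + f (i + 2) := by
  rw [Fin.sum_univ_three]
  fin_cases i <;> simp <;> abel

variable (B : AffineBasis (Fin 3) ℝ (EuclideanSpace ℝ (Fin 2)))

/-- The side of a triangle opposite to the `i`-th vertex, as a vector. -/
def sideVector (i : Fin 3) : EuclideanSpace ℝ (Fin 2) := B (i + 2) - B (i + 1)

/-- Twice the signed area of a triangle. -/
def doubleArea : ℝ := planeOrientation.areaForm (B 1 - B 0) (B 2 - B 0)

theorem areaForm_sideVector_vertex_sub (i : Fin 3) :
    planeOrientation.areaForm (sideVector B i) (B i - B (i + 1)) = doubleArea B := by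
  have swap := planeOrientation.areaForm_swap
  fin_cases i <;>
    simp [sideVector, doubleArea] <;>
    linarith [swap (B 0) (B 1), swap (B 1) (B 2), swap (B 0) (B 2)]

theorem areaForm_sideVector_sub (i : Fin 3) (x : EuclideanSpace ℝ (Fin 2)) :
    planeOrientation.areaForm (sideVector B i) (x - B (i + 1)) = B.coord i x * doubleArea B := by
  have hsub : x - B (i + 1) =
      B.coord i x • (B i - B (i + 1)) + B.coord (i + 2) x • sideVector B i := by
    have hsum := B.sum_coord_apply_eq_one x
    have hcomb := B.linear_combination_coord_eq_self x
    rw [sum_fin_three_eq_add_add _ i] at hsum hcomb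
    linear_combination (norm := (rw [sideVector]; module)) hsum • B (i + 1) - hcomb
  rw [hsub, map_add, map_smul, map_smul, planeOrientation.areaForm_apply_self,
    areaForm_sideVector_vertex_sub, smul_zero, add_zero, smul_eq_mul]

theorem rightAngleRotation_sideVector (i : Fin 3) :
    planeOrientation.rightAngleRotation (sideVector B i) = doubleArea B • coordGradient B i := by
  refine ext_inner_right ℝ fun y => ?_
  have hinner := inner_coordGradient B i (y + B (i + 1)) (B (i + 1))
  have harea := areaForm_sideVector_sub B i (y + B (i + 1))
  rw [add_sub_cancel_right] at hinner harea
  rw [planeOrientation.inner_rightAngleRotation_left, harea, real_inner_smul_left, hinner,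
    B.coord_apply_ne (by simp), sub_zero, mul_comm]

theorem norm_sideVector (i : Fin 3) :
    ‖sideVector B i‖ = |doubleArea B| * ‖coordGradient B i‖ := by
  rw [← planeOrientation.rightAngleRotation.norm_map, rightAngleRotation_sideVector, norm_smul,
    Real.norm_eq_abs]

theorem facet_eq_segment (i : Fin 3) : facet B i = segment ℝ (B (i + 1)) (B (i + 2)) := by
  ext x
  constructor
  · rintro ⟨hnonneg, hzero⟩
    have hsum := B.sum_coord_apply_eq_one x
    have hcomb := B.linear_combination_coord_eq_self x
    rw [sum_fin_three_eq_add_add _ i, hzero, zero_add] at hsum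
    rw [sum_fin_three_eq_add_add _ i, hzero, zero_smul, zero_add] at hcomb
    exact ⟨_, _, hnonneg _, hnonneg _, hsum, hcomb⟩
  · rintro ⟨s, t, hs, ht, hst, rfl⟩
    have hcoord (j : Fin 3) : B.coord j (s • B (i + 1) + t • B (i + 2)) =
        s * (if j = i + 1 then 1 else 0) + t * (if j = i + 2 then 1 else 0) := by
      rw [Convex.combo_affine_apply hst, B.coord_apply, B.coord_apply, smul_eq_mul, smul_eq_mul]
    refine ⟨fun j => ?_, ?_⟩
    · rw [hcoord]
      positivity
    · rw [hcoord]
      simp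

theorem facet_inter_facet_subset (i : Fin 3) : facet B i ∩ facet B (i + 1) ⊆ {B (i + 2)} := by
  rintro x ⟨⟨-, hi⟩, -, hsucc⟩
  have hsum := B.sum_coord_apply_eq_one x
  have hcomb := B.linear_combination_coord_eq_self x
  rw [sum_fin_three_eq_add_add _ i, hi, hsucc, zero_add, zero_add] at hsum
  rw [sum_fin_three_eq_add_add _ i, hi, hsucc, hsum, zero_smul, zero_smul, one_smul, zero_add,
    zero_add] at hcomb
  exact hcomb.symm

theorem subsingleton_facet_inter_facet {i j : Fin 3} (hij : i ≠ j) :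
    (facet B i ∩ facet B j).Subsingleton := by
  have hsucc : j = i + 1 ∨ i = j + 1 := by
    revert i j
    decide
  rcases hsucc with rfl | rfl
  · exact subsingleton_singleton.anti (facet_inter_facet_subset B i)
  · exact inter_comm _ _ ▸ subsingleton_singleton.anti (facet_inter_facet_subset B j)

theorem perimeter_triangle :
    perimeter (interior (convexHull ℝ (range B))) = ∑ i, ‖sideVector B i‖ := by
  have := Measure.nullSingletonClass_hausdorff (EuclideanSpace ℝ (Fin 2)) one_pos
  have hdisj : Pairwise (Function.onFun (AEDisjoint (Measure.hausdorffMeasure 1)) (facet B)) :=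
    fun i j hij => (subsingleton_facet_inter_facet B hij).measure_zero _
  have hlength (i : Fin 3) :
      Measure.hausdorffMeasure 1 (facet B i) = ENNReal.ofReal ‖sideVector B i‖ := by
    rw [facet_eq_segment, hausdorffMeasure_segment, edist_comm, edist_dist, dist_eq_norm,
      sideVector]
  rw [perimeter, frontier_interior_convexHull, Measure.real,
    measure_iUnion₀ hdisj fun i => (isClosed_facet B i).measurableSet.nullMeasurableSet,
    tsum_fintype]
  simp only [hlength]
  rw [← ENNReal.ofReal_sum_of_nonneg fun i _ => norm_nonneg _,
    ENNReal.toReal_ofReal (Finset.sum_nonneg fun i _ => norm_nonneg _)]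

end Triangle

section Area

theorem volume_standardTriangle :
    volume {z : EuclideanSpace ℝ (Fin 2) | 0 < z 0 ∧ 0 < z 1 ∧ z 0 + z 1 < 1} =
      ENNReal.ofReal (1 / 2) := by
  have hpres := (volume_preserving_finTwoArrow ℝ).comp
    (EuclideanSpace.volume_preserving_symm_measurableEquiv_toLp (Fin 2))
  have hcont : Continuous fun t : ℝ => 1 - t := by fun_prop
  have hpreimage : {z : EuclideanSpace ℝ (Fin 2) | 0 < z 0 ∧ 0 < z 1 ∧ z 0 + z 1 < 1} =
      (MeasurableEquiv.finTwoArrow ∘ (MeasurableEquiv.toLp 2 (Fin 2 → ℝ)).symm) ⁻¹'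
        regionBetween (fun _ => 0) (fun t => 1 - t) (Ioo (0 : ℝ) 1) := by
    ext z
    change _ ↔ (0 < z 0 ∧ z 0 < 1) ∧ 0 < z 1 ∧ z 1 < 1 - z 0
    grind
  rw [hpreimage, hpres.measure_preimage (measurableSet_regionBetween measurable_const
      hcont.measurable measurableSet_Ioo).nullMeasurableSet, Measure.volume_eq_prod,
    volume_regionBetween_eq_integral (integrableOn_zero)
      (hcont.integrableOn_Icc.mono_set Ioo_subset_Icc_self) measurableSet_Ioo
      fun t ht => sub_nonneg.2 ht.2.le,
    ← integral_Ioc_eq_integral_Ioo, ← intervalIntegral.integral_of_le zero_le_one]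
  norm_num [intervalIntegral.integral_comp_sub_left fun t : ℝ => t]

variable (B : AffineBasis (Fin 3) ℝ (EuclideanSpace ℝ (Fin 2)))

/-- The linear part of the affine map that sends the vertices `0`, `e₁`, `e₂` of the standard
triangle to the vertices of a given one. -/
def edgeMap : EuclideanSpace ℝ (Fin 2) →ₗ[ℝ] EuclideanSpace ℝ (Fin 2) :=
  (EuclideanSpace.basisFun (Fin 2) ℝ).toBasis.constr ℝ ![B 1 - B 0, B 2 - B 0]

theorem edgeMap_apply (z : EuclideanSpace ℝ (Fin 2)) :
    edgeMap B z = z 0 • (B 1 - B 0) + z 1 • (B 2 - B 0) := by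
  simp [edgeMap, Module.Basis.constr_apply_fintype]

theorem det_edgeMap : LinearMap.det (edgeMap B) = doubleArea B := by
  have hcomp : edgeMap B ∘ (EuclideanSpace.basisFun (Fin 2) ℝ).toBasis =
      ![B 1 - B 0, B 2 - B 0] := funext fun i => Module.Basis.constr_basis ..
  rw [doubleArea, planeOrientation.areaForm_to_volumeForm,
    planeOrientation.volumeForm_robust (EuclideanSpace.basisFun (Fin 2) ℝ) rfl, ← hcomp,
    Module.Basis.det_comp, Module.Basis.det_self, mul_one]

theorem preimage_edgeMap :
    (fun z => B 0 + edgeMap B z) ⁻¹' interior (convexHull ℝ (range B)) =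
      {z | 0 < z 0 ∧ 0 < z 1 ∧ z 0 + z 1 < 1} := by
  ext z
  have hweights : ∑ i, (![1 - z 0 - z 1, z 0, z 1] : Fin 3 → ℝ) i = 1 := by
    simp only [Fin.sum_univ_three, Matrix.cons_val]
    ring
  have hcomb : B 0 + edgeMap B z = ∑ i, (![1 - z 0 - z 1, z 0, z 1] : Fin 3 → ℝ) i • B i := by
    simp only [Fin.sum_univ_three, Matrix.cons_val, edgeMap_apply]
    module
  rw [mem_preimage, B.interior_convexHull, mem_ofPred_eq, hcomb]
  simp only [coord_sum_smul B hweights, Fin.forall_fin_succ, Matrix.cons_val_zero,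
    Matrix.cons_val_succ, Matrix.cons_val_fin_one, forall_const, mem_ofPred_eq]
  grind

theorem surjective_add_edgeMap : Function.Surjective fun z => B 0 + edgeMap B z := by
  intro x
  have hsum := B.sum_coord_apply_eq_one x
  have hcomb := B.linear_combination_coord_eq_self x
  rw [Fin.sum_univ_three] at hsum hcomb
  refine ⟨!₂[B.coord 1 x, B.coord 2 x], ?_⟩
  simp only [edgeMap_apply, Matrix.cons_val]
  linear_combination (norm := module) hcomb - hsum • B 0

theorem volume_triangle :
    volume.real (interior (convexHull ℝ (range B))) = |doubleArea B| / 2 := by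
  rw [← image_preimage_eq (interior _) (surjective_add_edgeMap B), preimage_edgeMap,
    ← image_image (B 0 + ·), image_add_left, Measure.real, measure_preimage_add,
    Measure.addHaar_image_linearMap, det_edgeMap, volume_standardTriangle,
    ← ENNReal.ofReal_mul (abs_nonneg _), ENNReal.toReal_ofReal (by positivity), mul_one_div]

end Area

theorem exists_affineBasis_of_mem_triangles {T : Set (EuclideanSpace ℝ (Fin 2))}
    (hT : T ∈ triangles) : ∃ B : AffineBasis (Fin 3) ℝ (EuclideanSpace ℝ (Fin 2)),
      T = interior (convexHull ℝ (range B)) := by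
  obtain ⟨a, b, c, hind, rfl⟩ := hT
  refine ⟨⟨![a, b, c], hind, hind.affineSpan_eq_top_iff_card_eq_finrank_add_one.2 (by simp)⟩, ?_⟩
  congr 2
  change _ = range ![a, b, c]
  simp only [Matrix.range_cons, Matrix.range_empty, union_empty, singleton_union]

theorem triangles_nonempty : triangles.Nonempty := by
  obtain ⟨B⟩ := AffineBasis.exists_affineBasis_of_finiteDimensional (ι := Fin 3) (k := ℝ)
    (P := EuclideanSpace ℝ (Fin 2)) (by simp)
  refine ⟨_, B 0, B 1, B 2, ?_, rfl⟩
  have hvertices : ![B 0, B 1, B 2] = B := FinVec.etaExpand_eq B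
  exact hvertices ▸ B.ind

theorem inradius_mul_perimeter_div_volume
    (B : AffineBasis (Fin 3) ℝ (EuclideanSpace ℝ (Fin 2))) :
    inradius (interior (convexHull ℝ (range B))) *
      perimeter (interior (convexHull ℝ (range B))) /
        volume.real (interior (convexHull ℝ (range B))) = 2 := by
  have hcirc := isCircumscribed_interior_convexHull B
  have hgrad : ∑ i, ‖coordGradient B i‖ ≠ 0 := (inv_pos.1 hcirc.pos).ne'
  have harea : |doubleArea B| ≠ 0 := by
    have hvolume := hcirc.volume_pos
    rw [volume_triangle] at hvolume
    exact (by linarith : 0 < |doubleArea B|).ne'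
  rw [hcirc.inradius_eq, perimeter_triangle, volume_triangle]
  simp only [norm_sideVector]
  rw [← Finset.mul_sum]
  field_simp

theorem div_le_gamma {D : ℕ} {F : Set (Set (EuclideanSpace ℝ (Fin D)))} {p a b : ℝ}
    (hF : F.Nonempty) (ha : 0 < a) (hQ : ∀ T ∈ F, a ≤ Q p T ∧ Q p T ≤ b) :
    a / b ≤ gamma F p := by
  obtain ⟨T, hT⟩ := hF
  have hupper : b ∈ upperBounds (Q p '' F) := forall_mem_image.2 fun S hS => (hQ S hS).2
  have hα : a ≤ alpha F p := le_csInf ⟨_, mem_image_of_mem _ hT⟩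
    (forall_mem_image.2 fun S hS => (hQ S hS).1)
  have hβ : beta F p ≤ b := csSup_le ⟨_, mem_image_of_mem _ hT⟩ hupper
  have hβ_pos : 0 < beta F p :=
    (ha.trans_le (hQ T hT).1).trans_le (le_csSup ⟨b, hupper⟩ (mem_image_of_mem _ hT))
  exact div_le_div₀ (ha.le.trans hα) hα hβ_pos hβ

end PTorsion

end

theorem mainTheorem7 (p : ℝ) (hp : 1 < p) :
    (∀ T ∈ PTorsion.triangles,
      PTorsion.inradius T * PTorsion.perimeter T / volume.real T = 2) ∧
    (∀ T ∈ PTorsion.triangles, 1 ≤ PTorsion.Q p T ∧ PTorsion.Q p T < 2) ∧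
    1 / 2 ≤ PTorsion.gamma PTorsion.triangles p := by
  have hpq := Real.HolderConjugate.conjExponent hp
  have hQ : ∀ T ∈ PTorsion.triangles, 1 ≤ PTorsion.Q p T ∧ PTorsion.Q p T < 2 := by
    intro T hT
    obtain ⟨B, rfl⟩ := PTorsion.exists_affineBasis_of_mem_triangles hT
    have hcirc := PTorsion.isCircumscribed_interior_convexHull B
    exact ⟨hcirc.one_le_Q hpq, mod_cast hcirc.Q_lt_dim hpq one_lt_two⟩
  refine ⟨fun T hT => ?_, hQ, PTorsion.div_le_gamma PTorsion.triangles_nonempty one_pos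
    fun T hT => (hQ T hT).imp_right le_of_lt⟩
  obtain ⟨B, rfl⟩ := PTorsion.exists_affineBasis_of_mem_triangles hT
  exact PTorsion.inradius_mul_perimeter_div_volume B
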